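/- All graphs are finite and simple. A graph is co-edge-regular if it is regular and there is a constant $\mu$ such that any two distinct non-adjacent vertices have exactly $\mu$ common neighbors. The spectrum of a graph is the multiset of eigenvalues of its adjacency matrix, with exponents denoting multiplicities. The $n\times n$-grid is the Cartesian product $K_n\,\Box\,K_n$ of two complete graphs. The $s$-clique extension of a graph $G$ is obtained by replacing each vertex $x$ of $G$ by a clique $\widetilde X$ with $s$ vertices, where for $x\neq y$ a vertex of $\widetilde X$ and a vertex of $\widetilde Y$ are adjacent if and only if $x$ and $y$ are adjacent in $G$. Theorem 1.1. Let $s\ge 2$ and $t\ge 1$ be integers. The $s$-clique extension of the $(t+1)\times(t+1)$-grid has spectrum $$\{(s(2t+1)-1)^{1},\ (st-1)^{2t},\ (-1)^{(s-1)(t+1)^2},\ (-s-1)^{t^2}\}.$$ Moreover, if $\Gamma$ is a co-edge-regular graph with this spectrum and $t\ge 11(s+1)^3(s+2)$, then $\Gamma$ is isomorphic to the $s$-clique extension of the $(t+1)\times(t+1)$-grid. -/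

import Mathlib

/-- A (finite, simple) graph is co-edge-regular if it is regular and there is a constant `μ` such
that any two distinct non-adjacent vertices have exactly `μ` common neighbors. -/
def SimpleGraph.IsCoEdgeRegular {V : Type*} [Fintype V] (G : SimpleGraph V)
    [DecidableRel G.Adj] : Prop :=
  (∃ k : ℕ, G.IsRegularOfDegree k) ∧
    ∃ μ : ℕ, ∀ x y : V, x ≠ y → ¬ G.Adj x y → Fintype.card (G.commonNeighbors x y) = μ

/-- The spectrum of a finite graph: the multiset of eigenvalues of its real adjacency matrix,
each one repeated according to its multiplicity (as a root of the characteristic polynomial). -/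
noncomputable def SimpleGraph.adjSpectrum {V : Type*} [Fintype V] [DecidableEq V]
    (G : SimpleGraph V) [DecidableRel G.Adj] : Multiset ℝ :=
  (G.adjMatrix ℝ).charpoly.roots

/-- The `s`-clique extension of `G`: each vertex `x` is replaced by a clique `{x} × Fin s`, and
vertices in the cliques of two distinct vertices `x`, `y` are adjacent iff `x` and `y` are. -/
def SimpleGraph.cliqueExtension {V : Type*} (G : SimpleGraph V) (s : ℕ) :
    SimpleGraph (V × Fin s) where
  Adj p q := G.Adj p.1 q.1 ∨ (p.1 = q.1 ∧ p.2 ≠ q.2)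
  symm := ⟨fun _ _ h => h.imp (fun h => h.symm) (fun h => ⟨h.1.symm, h.2.symm⟩)⟩
  loopless := ⟨fun p h => h.elim (fun h => G.loopless.irrefl p.1 h) (fun h => h.2 rfl)⟩

instance SimpleGraph.cliqueExtension.instDecidableRelAdj {V : Type*} [DecidableEq V]
    (G : SimpleGraph V) [DecidableRel G.Adj] (s : ℕ) :
    DecidableRel (G.cliqueExtension s).Adj :=
  fun p q => inferInstanceAs (Decidable (G.Adj p.1 q.1 ∨ (p.1 = q.1 ∧ p.2 ≠ q.2)))

/-- The `n × n`-grid: the Cartesian product of two complete graphs on `n` vertices. -/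
def squareGrid (n : ℕ) : SimpleGraph (Fin n × Fin n) :=
  (⊤ : SimpleGraph (Fin n)).boxProd (⊤ : SimpleGraph (Fin n))

instance squareGrid.instDecidableRelAdj (n : ℕ) : DecidableRel (squareGrid n).Adj :=
  fun p q => decidable_of_iff ((p.1 ≠ q.1 ∧ p.2 = q.2) ∨ (p.2 ≠ q.2 ∧ p.1 = q.1)) (by
    simp only [squareGrid, SimpleGraph.boxProd_adj, SimpleGraph.top_adj])

/-- The multiset
`{(s(2t+1)-1)^1, (st-1)^(2t), (-1)^((s-1)(t+1)^2), (-s-1)^(t^2)}` of real numbers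
(exponents are multiplicities; it is used for `s ≥ 2` and `t ≥ 1` only). -/
def gridExtensionSpectrum (s t : ℕ) : Multiset ℝ :=
  Multiset.replicate 1 ((s : ℝ) * (2 * t + 1) - 1) +
    Multiset.replicate (2 * t) ((s : ℝ) * t - 1) +
    Multiset.replicate ((s - 1) * (t + 1) ^ 2) (-1 : ℝ) +
    Multiset.replicate (t ^ 2) (-(s : ℝ) - 1)

/-!
Let `A` be the adjacency matrix of the `s`-clique extension of the grid. Then `A + 1` is
`(J ⊗ 1 + 1 ⊗ J - 1) ⊗ J` with all-ones matrices `J`, and diagonalizing these gives the spectrum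
(`adjSpectrum_cliqueExtension_squareGrid`).

Conversely let `G` be co-edge-regular with this spectrum, and `B = A + 1` for its own adjacency
matrix `A`. The traces of `1`, `A²` and `A³` give the order, the valency, and `μ = 2s`. As the
valency is a simple eigenvalue and there are only three others, a cubic polynomial in `B` is a
multiple of `J` (`cubic_of_adjSpectrum`). Put `D = B² - 2s J - s (t - 1) B`. Since `μ = 2s`, the
entry `D x y` vanishes unless `x` and `y` are equal or adjacent, when it is the number of common
closed neighbours minus `s (t + 1)`; the diagonal entries are `s t`, and the cubic relation becomes
`B D = s² t B`, whence `D² = s² t D` (`isGridLike_of_adjSpectrum`). In the clique extension, `D` has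
the entry `s t` at twins and `0` elsewhere, and the aim is to prove this for `G`.

The squares in a row of `D` have the sum `s³ t²`, so all but `O(s)` neighbours of a vertex `x` have
a small defect. Among those no three are pairwise non-adjacent, because two non-adjacent vertices
have only `2s` common neighbours. Hence they are covered by two cliques up to `O(s)` exceptions, and
there are exactly two lines (large maximal cliques) through `x` (`exists_linePair`,
`eq_or_eq_of_linePair`). The defect of `x` and `y` is then near `-s t`, `0` or `s t` according as
`y` is on no, one or both lines through `x`. The relation `B D = s² t B` at a suitable non-adjacent
pair excludes the value near `-s t` (`closedNbhd_eq_union`), and at adjacent pairs it shows that two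
lines that meet share exactly `s` vertices (`card_inter_lines`). The sum of the squares then forces
all other defects to vanish (`defect_eq_zero`), so lines have `s (t + 1)` vertices and form no
triangles (`card_line_and_not_adj`). With `μ = 2s` this makes the lines the rows and columns of a
grid whose cells have `s` vertices (`IsGridLike.nonempty_iso`).
-/

section

open Finset

namespace SimpleGraph

/-! ### Defects -/

variable {V : Type*} [Fintype V] [DecidableEq V]

/-- The closed neighbourhood of `x`, that is, the neighbours of `x` together with `x`. -/
def closedNbhd (G : SimpleGraph V) [DecidableRel G.Adj] (x : V) : Finset V :=
  insert x (G.neighborFinset x)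

/-- The entry at `(x, y)` of `B² - 2s J - s(t - 1) B`, where `B = A + 1`, for a graph in which
non-adjacent vertices have `2s` common neighbours: it compares the number of common neighbours of
`x` and `y` with the number that two non-twin adjacent vertices of the `s`-clique extension of the
grid have. -/
noncomputable def defect (G : SimpleGraph V) [DecidableRel G.Adj] (s t : ℕ) (x y : V) : ℝ :=
  if y ∈ G.closedNbhd x then (#(G.closedNbhd x ∩ G.closedNbhd y) : ℝ) - s * (t + 1) else 0

/-- The consequences of the spectrum and of co-edge-regularity from which the structure of the
graph is recovered. In matrix form, with `B = A + 1` and `D` the matrix of defects, the last three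
fields say `B D = s² t B`, `D 1 = s² t 1` and `D² = s² t D`. -/
structure IsGridLike (G : SimpleGraph V) [DecidableRel G.Adj] (s t : ℕ) : Prop where
  card_closedNbhd : ∀ x, #(G.closedNbhd x) = s * (2 * t + 1)
  card_inter : ∀ x y, y ∉ G.closedNbhd x → #(G.closedNbhd x ∩ G.closedNbhd y) = 2 * s
  sum_closedNbhd : ∀ z y, ∑ w ∈ G.closedNbhd z, G.defect s t w y =
    if y ∈ G.closedNbhd z then (s : ℝ) ^ 2 * t else 0
  sum_defect : ∀ y, ∑ w, G.defect s t w y = (s : ℝ) ^ 2 * t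
  sum_mul : ∀ x y, ∑ w, G.defect s t x w * G.defect s t w y = (s : ℝ) ^ 2 * t * G.defect s t x y

variable {G : SimpleGraph V} [DecidableRel G.Adj] {s t : ℕ}

lemma mem_closedNbhd {x y : V} : y ∈ G.closedNbhd x ↔ y = x ∨ G.Adj x y := by
  simp [closedNbhd]

lemma self_mem_closedNbhd (x : V) : x ∈ G.closedNbhd x := by simp [closedNbhd]

lemma mem_closedNbhd_comm {x y : V} : y ∈ G.closedNbhd x ↔ x ∈ G.closedNbhd y := by
  rw [mem_closedNbhd, mem_closedNbhd, G.adj_comm, eq_comm]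

lemma defect_comm (x y : V) : G.defect s t x y = G.defect s t y x := by
  simp only [defect, inter_comm (G.closedNbhd x), mem_closedNbhd_comm (x := x)]

lemma defect_of_mem {x y : V} (h : y ∈ G.closedNbhd x) : G.defect s t x y =
    (#(G.closedNbhd x ∩ G.closedNbhd y) : ℝ) - s * (t + 1) := if_pos h

lemma defect_of_notMem {x y : V} (h : y ∉ G.closedNbhd x) : G.defect s t x y = 0 := if_neg h

lemma IsGridLike.card_inter_le (h : G.IsGridLike s t) {x y : V} (hxy : y ∉ G.closedNbhd x) :
    #(G.closedNbhd x ∩ G.closedNbhd y) ≤ 2 * s := (h.card_inter x y hxy).le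

lemma IsGridLike.cast_card (h : G.IsGridLike s t) (x : V) :
    (#(G.closedNbhd x) : ℝ) = s * (2 * t + 1) := by
  rw [h.card_closedNbhd]; push_cast; ring

lemma IsGridLike.defect_self (h : G.IsGridLike s t) (x : V) : G.defect s t x x = s * t := by
  rw [defect_of_mem (self_mem_closedNbhd x), inter_self, h.cast_card]; ring

lemma IsGridLike.sum_sq (h : G.IsGridLike s t) (x : V) :
    ∑ y, G.defect s t x y ^ 2 = (s : ℝ) ^ 3 * t ^ 2 := by
  have := h.sum_mul x x
  rw [h.defect_self] at this
  calc _ = ∑ w, G.defect s t x w * G.defect s t w x :=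
        sum_congr rfl fun w _ => by rw [defect_comm w x, sq]
    _ = _ := by rw [this]; ring

/-- Restricting the sum of squares of the defects at `x` to a set of vertices other than `x`. -/
lemma IsGridLike.sum_sq_le (h : G.IsGridLike s t) (x : V) (S : Finset V) (hS : x ∉ S) :
    ∑ y ∈ S, G.defect s t x y ^ 2 ≤ ((s : ℝ) - 1) * s ^ 2 * t ^ 2 := by
  have h1 : ∑ y ∈ insert x S, G.defect s t x y ^ 2 ≤ (s : ℝ) ^ 3 * t ^ 2 := by
    rw [← h.sum_sq x]
    exact sum_le_sum_of_subset_of_nonneg (subset_univ _) fun _ _ _ => sq_nonneg _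
  rw [sum_insert hS, h.defect_self] at h1
  linarith

/-! ### Maximal cliques -/

/-- A line is a maximal clique (`C` equals the common closed neighbourhood of its members) with at
least `s t / 2` vertices. -/
def IsLine (G : SimpleGraph V) [DecidableRel G.Adj] (s t : ℕ) (C : Finset V) : Prop :=
  (∀ y, y ∈ C ↔ ∀ x ∈ C, y ∈ G.closedNbhd x) ∧ s * t ≤ 2 * #C

lemma IsLine.subset {C : Finset V} (hC : G.IsLine s t C) {x : V} (hx : x ∈ C) :
    C ⊆ G.closedNbhd x := fun _ hy => (hC.1 _).1 hy x hx

/-- Every clique lies in a set that is its own set of common closed neighbours. -/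
lemma exists_maximal_clique (C : Finset V) (hC : ∀ x ∈ C, ∀ y ∈ C, y ∈ G.closedNbhd x) :
    ∃ D, C ⊆ D ∧ ∀ y, y ∈ D ↔ ∀ x ∈ D, y ∈ G.closedNbhd x := by
  obtain ⟨D, hCD, hD⟩ := (Set.toFinite
    {D : Finset V | ∀ x ∈ D, ∀ y ∈ D, y ∈ G.closedNbhd x}).exists_le_maximal hC
  refine ⟨D, hCD, fun y => ⟨fun hy x hx => hD.prop x hx y hy, fun hy => ?_⟩⟩
  have : insert y D ∈ {D : Finset V | ∀ x ∈ D, ∀ y ∈ D, y ∈ G.closedNbhd x} := by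
    intro a ha b hb
    rcases mem_insert.1 ha with rfl | ha' <;> rcases mem_insert.1 hb with rfl | hb'
    · exact self_mem_closedNbhd _
    · exact mem_closedNbhd_comm.1 (hy b hb')
    · exact hy a ha'
    · exact hD.prop a ha' b hb'
  exact hD.le_of_ge this (subset_insert _ _) (mem_insert_self _ _)

lemma IsGridLike.card_inter_line_le (h : G.IsGridLike s t) {C : Finset V} (hC : G.IsLine s t C)
    {z : V} (hz : z ∉ C) : #(G.closedNbhd z ∩ C) ≤ 2 * s := by
  rw [hC.1] at hz
  push Not at hz
  obtain ⟨w, hw, hzw⟩ := hz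
  exact (card_le_card (inter_comm (G.closedNbhd w) _ ▸ inter_subset_inter_left
    (hC.subset hw))).trans (h.card_inter_le hzw)

lemma IsLine.eq_of_subset {C D : Finset V} (hC : G.IsLine s t C) (hD : G.IsLine s t D)
    (h : C ⊆ D) : C = D :=
  h.antisymm fun y hy => (hC.1 y).2 fun _ hx => hD.subset (h hx) hy

lemma IsLine.exists_notMem {C D : Finset V} (hC : G.IsLine s t C) (hD : G.IsLine s t D)
    (h : C ≠ D) : ∃ z ∈ C, z ∉ D := by
  by_contra! H
  exact h (hC.eq_of_subset hD H)

lemma IsGridLike.card_line_inter_le (h : G.IsGridLike s t) {C D : Finset V}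
    (hC : G.IsLine s t C) (hD : G.IsLine s t D) (hne : C ≠ D) : #(C ∩ D) ≤ 2 * s := by
  obtain ⟨z, hz, hzD⟩ := hC.exists_notMem hD hne
  exact (card_le_card (inter_subset_inter_right (hC.subset hz))).trans
    (h.card_inter_line_le hD hzD)


/-! ### Two lines through each vertex -/

/-- The neighbours `y` of `x` whose defect is small: at most `s t / 4` in absolute value. -/
noncomputable def goodNbrs (G : SimpleGraph V) [DecidableRel G.Adj] (s t : ℕ) (x : V) : Finset V :=
  {y ∈ G.closedNbhd x | y ≠ x ∧ 4 * |G.defect s t x y| ≤ s * t}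

lemma mem_goodNbrs {x y : V} : y ∈ G.goodNbrs s t x ↔
    y ∈ G.closedNbhd x ∧ y ≠ x ∧ 4 * |G.defect s t x y| ≤ s * t := by simp [goodNbrs]

/-- The size of the common neighbourhood of `x` and a good neighbour. -/
lemma card_inter_of_mem_goodNbrs {x y : V} (hy : y ∈ G.goodNbrs s t x) :
    3 / 4 * (s * t : ℝ) + s ≤ #(G.closedNbhd x ∩ G.closedNbhd y) ∧
    (#(G.closedNbhd x ∩ G.closedNbhd y) : ℝ) ≤ 5 / 4 * (s * t) + s := by
  obtain ⟨h1, -, h2⟩ := mem_goodNbrs.1 hy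
  rw [defect_of_mem h1] at h2
  have h3 := abs_le.1 ((le_div_iff₀' (by norm_num : (0 : ℝ) < 4)).2 h2)
  constructor <;> linarith [h3.1, h3.2]

/-- Few neighbours are not good, because the squares of the defects at `x` have a bounded sum. -/
lemma IsGridLike.card_bad_le (h : G.IsGridLike s t) (hs : 2 ≤ s) (ht : 0 < t) (x : V) :
    #{y ∈ G.closedNbhd x | y ≠ x ∧ y ∉ G.goodNbrs s t x} ≤ 16 * (s - 1) := by
  set S := {y ∈ G.closedNbhd x | y ≠ x ∧ y ∉ G.goodNbrs s t x} with hS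
  have hs' : (2 : ℝ) ≤ s := by exact_mod_cast hs
  have ht' : (0 : ℝ) < t := by exact_mod_cast ht
  have h1 := h.sum_sq_le x S (by simp [hS])
  have h2 : ∀ y ∈ S, ((s : ℝ) * t / 4) ^ 2 ≤ G.defect s t x y ^ 2 := by
    intro y hy
    simp only [hS, mem_filter, mem_goodNbrs, not_and, not_le] at hy
    have := hy.2.2 hy.1 hy.2.1
    rw [sq_le_sq, abs_of_nonneg (by positivity)]
    linarith
  have h3 := (card_nsmul_le_sum S _ _ h2).trans h1
  rw [nsmul_eq_mul] at h3
  have h4 : (#S : ℝ) ≤ 16 * (s - 1) := by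
    have : (0 : ℝ) < (s * t) ^ 2 := by positivity
    refine le_of_mul_le_mul_right ?_ this
    linarith
  have h5 : ((s - 1 : ℕ) : ℝ) = s - 1 := by push_cast [show 1 ≤ s by omega]; ring
  rw [← h5] at h4
  exact_mod_cast h4

lemma IsGridLike.le_card_goodNbrs (h : G.IsGridLike s t) (hs : 2 ≤ s) (ht : 0 < t) (x : V) :
    (s * (2 * t + 1) : ℝ) ≤ #(G.goodNbrs s t x) + 16 * s - 15 := by
  have h1 := h.card_bad_le hs ht x
  have h2 : G.closedNbhd x ⊆
      {x} ∪ G.goodNbrs s t x ∪ {y ∈ G.closedNbhd x | y ≠ x ∧ y ∉ G.goodNbrs s t x} := by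
    intro y hy
    simp only [mem_union, mem_singleton, mem_filter]
    tauto
  have h3 := card_le_card h2
  have h4 := card_union_le ({x} ∪ G.goodNbrs s t x)
    {y ∈ G.closedNbhd x | y ≠ x ∧ y ∉ G.goodNbrs s t x}
  have h5 := card_union_le {x} (G.goodNbrs s t x)
  rw [card_singleton] at h5
  rw [h.card_closedNbhd] at h3
  have h6 : s * (2 * t + 1) + 15 ≤ #(G.goodNbrs s t x) + 16 * s := by omega
  have h7 : (s * (2 * t + 1) + 15 : ℝ) ≤ #(G.goodNbrs s t x) + 16 * s := by exact_mod_cast h6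
  linarith

lemma _root_.Finset.card_add_card_add_card_le {α : Type*} [DecidableEq α]
    (A B C : Finset α) :
    #A + #B + #C ≤ #(A ∪ B ∪ C) + #(A ∩ B) + #(A ∩ C) + #(B ∩ C) := by
  have h1 := card_union_add_card_inter A B
  have h2 := card_union_add_card_inter (A ∪ B) C
  have h3 := card_union_le (A ∩ C) (B ∩ C)
  rw [← union_inter_distrib_right] at h3
  omega

/-- Among three good neighbours two are adjacent: otherwise their closed neighbourhoods, almost
disjoint and of size about `s t` inside that of `x`, would not fit in the latter. -/
lemma IsGridLike.not_indep_triple (h : G.IsGridLike s t) (hs : 2 ≤ s) (ht : 17 ≤ t) {x a b c : V}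
    (ha : a ∈ G.goodNbrs s t x) (hb : b ∈ G.goodNbrs s t x) (hc : c ∈ G.goodNbrs s t x)
    (hab : b ∉ G.closedNbhd a) (hac : c ∉ G.closedNbhd a) : c ∈ G.closedNbhd b := by
  by_contra hbc
  have key := card_add_card_add_card_le (G.closedNbhd x ∩ G.closedNbhd a)
    (G.closedNbhd x ∩ G.closedNbhd b) (G.closedNbhd x ∩ G.closedNbhd c)
  simp only [← inter_union_distrib_left, ← inter_inter_distrib_left] at key
  have h0 := card_le_card (inter_subset_left (s₁ := G.closedNbhd x)
    (s₂ := G.closedNbhd a ∪ G.closedNbhd b ∪ G.closedNbhd c))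
  have h1 := card_le_card (inter_subset_right (s₁ := G.closedNbhd x)
    (s₂ := G.closedNbhd a ∩ G.closedNbhd b))
  have h2 := card_le_card (inter_subset_right (s₁ := G.closedNbhd x)
    (s₂ := G.closedNbhd a ∩ G.closedNbhd c))
  have h3 := card_le_card (inter_subset_right (s₁ := G.closedNbhd x)
    (s₂ := G.closedNbhd b ∩ G.closedNbhd c))
  rw [h.card_inter _ _ hab] at h1
  rw [h.card_inter _ _ hac] at h2
  rw [h.card_inter _ _ hbc] at h3
  rw [h.card_closedNbhd] at h0
  have h4 : #(G.closedNbhd x ∩ G.closedNbhd a) + #(G.closedNbhd x ∩ G.closedNbhd b) +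
    #(G.closedNbhd x ∩ G.closedNbhd c) ≤ s * (2 * t + 1) + 6 * s := by omega
  have h5 : (#(G.closedNbhd x ∩ G.closedNbhd a) + #(G.closedNbhd x ∩ G.closedNbhd b) +
    #(G.closedNbhd x ∩ G.closedNbhd c) : ℝ) ≤ s * (2 * t + 1) + 6 * s := by exact_mod_cast h4
  have hs' : (2 : ℝ) ≤ s := by exact_mod_cast hs
  have ht' : (17 : ℝ) ≤ t := by exact_mod_cast ht
  have := (card_inter_of_mem_goodNbrs ha).1
  have := (card_inter_of_mem_goodNbrs hb).1
  have := (card_inter_of_mem_goodNbrs hc).1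
  nlinarith

lemma IsGridLike.exists_goodNbrs_not_adj (h : G.IsGridLike s t) (hs : 2 ≤ s) (ht : 100 ≤ t)
    (x : V) : ∃ a ∈ G.goodNbrs s t x, ∃ b ∈ G.goodNbrs s t x, b ∉ G.closedNbhd a := by
  by_contra! H
  have hs' : (2 : ℝ) ≤ s := by exact_mod_cast hs
  have ht' : (100 : ℝ) ≤ t := by exact_mod_cast ht
  have h1 := h.le_card_goodNbrs hs (by omega) x
  have h2 : (0 : ℝ) < #(G.goodNbrs s t x) := by nlinarith
  obtain ⟨a, ha⟩ := card_pos.1 (Nat.cast_pos.1 h2)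
  have h3 : (#(G.goodNbrs s t x) : ℝ) ≤ #(G.closedNbhd x ∩ G.closedNbhd a) :=
    Nat.cast_le.2 (card_le_card fun b hb =>
      mem_inter.2 ⟨(mem_goodNbrs.1 hb).1, H a ha b hb⟩)
  have h4 := (card_inter_of_mem_goodNbrs ha).2
  nlinarith

/-- `L` and `M` are two lines through `x` that cover the neighbours of `x` up to `18 s`
exceptions. -/
structure IsLinePair (G : SimpleGraph V) [DecidableRel G.Adj] (s t : ℕ) (x : V)
    (L M : Finset V) : Prop where
  left : G.IsLine s t L
  right : G.IsLine s t M
  mem_left : x ∈ L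
  mem_right : x ∈ M
  ne : L ≠ M
  card_le : #(G.closedNbhd x \ (L ∪ M)) ≤ 18 * s

lemma IsLinePair.symm {x : V} {L M : Finset V} (h : G.IsLinePair s t x L M) :
    G.IsLinePair s t x M L :=
  ⟨h.right, h.left, h.mem_right, h.mem_left, h.ne.symm, union_comm L M ▸ h.card_le⟩

/-- The good neighbours of `x` not adjacent to a fixed good neighbour `a` extend to a line. -/
lemma IsGridLike.exists_line (h : G.IsGridLike s t) (hs : 2 ≤ s) (ht : 100 ≤ t) {x a : V}
    (ha : a ∈ G.goodNbrs s t x) : ∃ L, G.IsLine s t L ∧ x ∈ L ∧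
      ∀ y ∈ G.goodNbrs s t x, y ∉ G.closedNbhd a → y ∈ L := by
  -- `C` is a clique, as two non-adjacent members would form an independent triple with `a`.
  set C := {y ∈ G.goodNbrs s t x | y ∉ G.closedNbhd a} with hC
  obtain ⟨L, hCL, hL⟩ := exists_maximal_clique (G := G) (insert x C) (by
    intro u hu v hv
    simp only [hC, mem_insert, mem_filter] at hu hv
    rcases hu with rfl | hu <;> rcases hv with rfl | hv
    · exact self_mem_closedNbhd _
    · exact (mem_goodNbrs.1 hv.1).1
    · exact mem_closedNbhd_comm.1 (mem_goodNbrs.1 hu.1).1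
    · exact h.not_indep_triple hs (by omega) ha hu.1 hv.1 hu.2 hv.2)
  refine ⟨L, ⟨hL, ?_⟩, hCL (mem_insert_self _ _), fun y hy hya =>
    hCL (mem_insert_of_mem (mem_filter.2 ⟨hy, hya⟩))⟩
  have h1 : #C ≤ #L := card_le_card ((subset_insert _ _).trans hCL)
  have h2 : #(G.goodNbrs s t x) ≤ #C + #(G.closedNbhd x ∩ G.closedNbhd a) := by
    refine (card_le_card fun y hy => ?_).trans (card_union_le _ _)
    simp only [hC, mem_union, mem_filter, mem_inter]
    have := (mem_goodNbrs.1 hy).1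
    tauto
  have h3 : (#(G.goodNbrs s t x) : ℝ) ≤ #L + #(G.closedNbhd x ∩ G.closedNbhd a) := by
    exact_mod_cast h2.trans (by omega)
  have h4 := (card_inter_of_mem_goodNbrs ha).2
  have h5 := h.le_card_goodNbrs hs (by omega) x
  have hs' : (2 : ℝ) ≤ s := by exact_mod_cast hs
  have ht' : (100 : ℝ) ≤ t := by exact_mod_cast ht
  have : (s * t : ℝ) ≤ 2 * #L := by nlinarith
  exact_mod_cast this

lemma IsGridLike.exists_linePair (h : G.IsGridLike s t) (hs : 2 ≤ s) (ht : 100 ≤ t) (x : V) :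
    ∃ L M, G.IsLinePair s t x L M := by
  obtain ⟨a, ha, b, hb, hab⟩ := h.exists_goodNbrs_not_adj hs ht x
  obtain ⟨L, hL, hxL, hL'⟩ := h.exists_line hs ht ha
  obtain ⟨M, hM, hxM, hM'⟩ := h.exists_line hs ht hb
  have haM : a ∈ M := hM' a ha fun H => hab (mem_closedNbhd_comm.1 H)
  refine ⟨L, M, hL, hM, hxL, hxM, ?_, ?_⟩
  · rintro rfl
    exact hab (hL.subset haM (hL' b hb hab))
  · have h1 : G.closedNbhd x \ (L ∪ M) ⊆ {y ∈ G.closedNbhd x | y ≠ x ∧ y ∉ G.goodNbrs s t x} ∪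
        (G.closedNbhd a ∩ G.closedNbhd b) := by
      intro y hy
      obtain ⟨hy, hy'⟩ := mem_sdiff.1 hy
      rw [mem_union, not_or] at hy'
      have hyx : y ≠ x := fun e => hy'.1 (e ▸ hxL)
      by_cases hg : y ∈ G.goodNbrs s t x
      · exact mem_union_right _ (mem_inter.2
          ⟨of_not_not fun H => hy'.1 (hL' y hg H), of_not_not fun H => hy'.2 (hM' y hg H)⟩)
      · exact mem_union_left _ (mem_filter.2 ⟨hy, hyx, hg⟩)
    have h2 := (card_le_card h1).trans (card_union_le _ _)
    have h3 := h.card_bad_le hs (by omega) x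
    rw [h.card_inter a b hab] at h2
    omega

/-- There is no third line through `x`: it would meet each of the two lines in at most `2s`
points. -/
lemma IsGridLike.eq_or_eq_of_linePair (h : G.IsGridLike s t) (hs : 2 ≤ s) (ht : 100 ≤ t) {x : V}
    {L M K : Finset V} (hLM : G.IsLinePair s t x L M) (hK : G.IsLine s t K) (hx : x ∈ K) :
    K = L ∨ K = M := by
  by_contra! H
  have h1 := h.card_line_inter_le hK hLM.left H.1
  have h2 := h.card_line_inter_le hK hLM.right H.2
  have h3 : K ⊆ (K ∩ L) ∪ (K ∩ M) ∪ (G.closedNbhd x \ (L ∪ M)) := by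
    intro y hy
    have := hK.subset hx hy
    simp only [mem_sdiff, mem_union, mem_inter]
    tauto
  have h4 := (card_le_card h3).trans (card_union_le _ _)
  have h5 := card_union_le (K ∩ L) (K ∩ M)
  have h6 := hLM.card_le
  have h7 := hK.2
  have h8 : s * t ≤ s * 44 := by omega
  have := Nat.le_of_mul_le_mul_left h8 (by omega)
  omega


/-! ### The defect takes values near `-s t`, `0` and `s t` -/

lemma IsGridLike.defect_le_of_notMem_lines (h : G.IsGridLike s t) {x y : V} {L M : Finset V}
    (hLM : G.IsLinePair s t x L M) (hy : y ∈ G.closedNbhd x) (hyL : y ∉ L) (hyM : y ∉ M) :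
    G.defect s t x y ≤ 21 * s - s * t := by
  have h1 : G.closedNbhd x ∩ G.closedNbhd y ⊆
      (G.closedNbhd y ∩ L) ∪ (G.closedNbhd y ∩ M) ∪ (G.closedNbhd x \ (L ∪ M)) := by
    intro z hz
    simp only [mem_sdiff, mem_union, mem_inter] at hz ⊢
    tauto
  have h2 := (card_le_card h1).trans (card_union_le _ _)
  have h3 := card_union_le (G.closedNbhd y ∩ L) (G.closedNbhd y ∩ M)
  have h4 := h.card_inter_line_le hLM.left hyL
  have h5 := h.card_inter_line_le hLM.right hyM
  have h6 := hLM.card_le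
  have h7 : (#(G.closedNbhd x ∩ G.closedNbhd y) : ℝ) ≤ 22 * s := by
    exact_mod_cast (show _ ≤ 22 * s by omega)
  rw [defect_of_mem hy]
  linarith

lemma IsGridLike.le_defect_of_mem_lines (h : G.IsGridLike s t) {x y : V} {L M : Finset V}
    (hLM : G.IsLinePair s t x L M) (hyL : y ∈ L) (hyM : y ∈ M) :
    s * t - 18 * s ≤ G.defect s t x y := by
  have h1 : G.closedNbhd x ⊆
      (G.closedNbhd x ∩ G.closedNbhd y) ∪ (G.closedNbhd x \ (L ∪ M)) := by
    intro z hz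
    have h1 : z ∈ L → z ∈ G.closedNbhd y := fun H => hLM.left.subset hyL H
    have h2 : z ∈ M → z ∈ G.closedNbhd y := fun H => hLM.right.subset hyM H
    simp only [mem_sdiff, mem_union, mem_inter]
    tauto
  have h2 := (card_le_card h1).trans (card_union_le _ _)
  have h3 : #(G.closedNbhd x) ≤ #(G.closedNbhd x ∩ G.closedNbhd y) + 18 * s :=
    h2.trans (Nat.add_le_add_left hLM.card_le _)
  have h4 : (#(G.closedNbhd x) : ℝ) ≤ #(G.closedNbhd x ∩ G.closedNbhd y) + 18 * s := by
    exact_mod_cast h3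
  rw [h.cast_card] at h4
  rw [defect_of_mem (hLM.left.subset hLM.mem_left hyL)]
  linarith

lemma IsGridLike.defect_mem_window (h : G.IsGridLike s t) {x y : V} {L M : Finset V}
    (hLM : G.IsLinePair s t x L M) (hyL : y ∈ L) (hyM : y ∉ M) :
    (#L : ℝ) - s * (t + 1) ≤ G.defect s t x y ∧
      G.defect s t x y ≤ #L - s * (t + 1) + 20 * s := by
  have h0 : L ⊆ G.closedNbhd x ∩ G.closedNbhd y :=
    subset_inter (hLM.left.subset hLM.mem_left) (hLM.left.subset hyL)
  have h1 : G.closedNbhd x ∩ G.closedNbhd y ⊆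
      L ∪ (G.closedNbhd y ∩ M) ∪ (G.closedNbhd x \ (L ∪ M)) := by
    intro z hz
    simp only [mem_sdiff, mem_union, mem_inter] at hz ⊢
    tauto
  have h2 := (card_le_card h1).trans (card_union_le _ _)
  have h3 := card_union_le L (G.closedNbhd y ∩ M)
  have h5 := h.card_inter_line_le hLM.right hyM
  have h6 := hLM.card_le
  have h7 : (#(G.closedNbhd x ∩ G.closedNbhd y) : ℝ) ≤ #L + 20 * s := by
    exact_mod_cast (show _ ≤ #L + 20 * s by omega)
  have h8 : (#L : ℝ) ≤ #(G.closedNbhd x ∩ G.closedNbhd y) := by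
    exact_mod_cast card_le_card h0
  rw [defect_of_mem (hLM.left.subset hLM.mem_left hyL)]
  constructor <;> linarith

lemma real_bounds (hs : 2 ≤ s) (ht : 132 * (s + 1) ^ 2 ≤ t) :
    (2 : ℝ) ≤ s ∧ 132 * ((s : ℝ) + 1) ^ 2 ≤ t ∧ 396 * ((s : ℝ) + 1) ≤ t := by
  have h1 : (2 : ℝ) ≤ s := by exact_mod_cast hs
  have h2 : 132 * ((s : ℝ) + 1) ^ 2 ≤ t := by exact_mod_cast ht
  exact ⟨h1, h2, by nlinarith⟩

lemma hundred_le_of_bound (hs : 2 ≤ s) (ht : 132 * (s + 1) ^ 2 ≤ t) : 100 ≤ t := by nlinarith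

/-- On one line only, the defect is small: it varies little along the line, and the line is so
long that the sum of the squares bounds it. -/
lemma IsGridLike.abs_defect_le (h : G.IsGridLike s t) (hs : 2 ≤ s) (ht : 132 * (s + 1) ^ 2 ≤ t)
    {x y : V} {L M : Finset V} (hLM : G.IsLinePair s t x L M) (hyL : y ∈ L) (hyM : y ∉ M) :
    5 * |G.defect s t x y| ≤ t := by
  obtain ⟨hs', ht', ht''⟩ := real_bounds hs ht
  by_contra! H
  have h1 : ∀ z ∈ L \ M, ((t : ℝ) / 7) ^ 2 ≤ G.defect s t x z ^ 2 := by
    intro z hz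
    rw [mem_sdiff] at hz
    obtain ⟨h1, h2⟩ := h.defect_mem_window hLM hz.1 hz.2
    obtain ⟨h3, h4⟩ := h.defect_mem_window hLM hyL hyM
    have h5 : |G.defect s t x y - G.defect s t x z| ≤ 20 * s := abs_le.2 ⟨by linarith, by linarith⟩
    have h6 := abs_sub_abs_le_abs_sub (G.defect s t x y) (G.defect s t x z)
    rw [sq_le_sq, abs_of_nonneg (by positivity)]
    linarith
  have h2 := (card_nsmul_le_sum _ _ _ h1).trans
    (h.sum_sq_le x (L \ M) (fun hx => (mem_sdiff.1 hx).2 hLM.mem_right))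
  have h3 : #L ≤ #(L \ M) + 2 * s := by
    have := card_sdiff_add_card_inter L M
    have := h.card_line_inter_le hLM.left hLM.right hLM.ne
    omega
  have h4 : (s * t : ℝ) ≤ 2 * (#(L \ M) + 2 * s) := by
    exact_mod_cast hLM.left.2.trans (Nat.mul_le_mul_left 2 h3)
  rw [nsmul_eq_mul] at h2
  have h5 : (#(L \ M) : ℝ) ≤ 49 * ((s - 1) * s ^ 2) := by
    refine le_of_mul_le_mul_right ?_ (show (0 : ℝ) < t ^ 2 by nlinarith)
    linarith
  have h6 : (s : ℝ) * t ≤ s * (98 * ((s - 1) * s) + 4) := by linarith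
  have h7 := le_of_mul_le_mul_left h6 (by linarith)
  nlinarith

/-- The squared distance of the rows of `D` at `w` and `y` is `2 s² t (s t - D w y)`. -/
lemma IsGridLike.sq_sub_le (h : G.IsGridLike s t) (w y x : V) :
    (G.defect s t w x - G.defect s t y x) ^ 2 ≤
      2 * s ^ 2 * t * (s * t - G.defect s t w y) := by
  calc _ ≤ ∑ v, (G.defect s t w v - G.defect s t y v) ^ 2 :=
        single_le_sum (f := fun v => (G.defect s t w v - G.defect s t y v) ^ 2)
          (fun _ _ => sq_nonneg _) (mem_univ x)
    _ = ∑ v, G.defect s t w v ^ 2 + ∑ v, G.defect s t y v ^ 2 -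
        2 * ∑ v, G.defect s t w v * G.defect s t v y := by
      rw [mul_sum, ← sum_add_distrib, ← sum_sub_distrib]
      exact sum_congr rfl fun v _ => by rw [defect_comm v y]; ring
    _ = _ := by rw [h.sum_sq, h.sum_sq, h.sum_mul]; ring

/-! ### Every neighbour of a vertex is on a line through it -/

lemma IsGridLike.sum_inter (h : G.IsGridLike s t) (z y : V) :
    ∑ w ∈ G.closedNbhd z ∩ G.closedNbhd y, G.defect s t w y =
      if y ∈ G.closedNbhd z then (s : ℝ) ^ 2 * t else 0 := by
  rw [← h.sum_closedNbhd z y]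
  refine sum_subset inter_subset_left fun w hw hw' => ?_
  exact defect_of_notMem fun H => hw' (mem_inter.2 ⟨hw, mem_closedNbhd_comm.1 H⟩)

/-- If `x` has defect near `-s t` with `y` then so has every `w` with defect near `s t` with `y`;
hence `w` is a neighbour of `x` outside the lines through `x`. -/
lemma IsGridLike.notMem_lines_of_defect (h : G.IsGridLike s t) (hs : 2 ≤ s)
    (ht : 132 * (s + 1) ^ 2 ≤ t) {x y w : V} {L M : Finset V} (hLM : G.IsLinePair s t x L M)
    (hxy : G.defect s t x y ≤ 21 * s - s * t) (hwy : s * t - 18 * s ≤ G.defect s t w y) :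
    w ∈ G.closedNbhd x \ (L ∪ M) := by
  obtain ⟨hs', ht', ht''⟩ := real_bounds hs ht
  -- The rows of `D` at `w` and `y` are close, so `D x w` is near `-s t` too.
  have h1 : 5 * G.defect s t x w < -t := by
    by_contra! H
    have h2 := h.sq_sub_le w y x
    rw [defect_comm w x, defect_comm y x] at h2
    have h3 : 3 * (s * t : ℝ) ≤ 5 * (G.defect s t x w - G.defect s t x y) := by nlinarith
    have h4 : (3 * (s * t : ℝ)) ^ 2 ≤ (5 * (G.defect s t x w - G.defect s t x y)) ^ 2 :=
      pow_le_pow_left₀ (by positivity) h3 2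
    have h5 : 2 * (s : ℝ) ^ 2 * t * (s * t - G.defect s t w y) ≤ 2 * s ^ 2 * t * (18 * s) :=
      mul_le_mul_of_nonneg_left (by linarith) (by positivity)
    have h6 : (s ^ 2 * t : ℝ) * t ≤ (s ^ 2 * t) * (100 * s) := by nlinarith
    have ht0 : (0 : ℝ) < t := by linarith
    have h7 := le_of_mul_le_mul_left h6 (by positivity)
    linarith
  have hw : w ∈ G.closedNbhd x := by
    by_contra H
    rw [defect_of_notMem H] at h1
    linarith
  refine mem_sdiff.2 ⟨hw, fun hmem => ?_⟩
  by_cases hwL : w ∈ L <;> by_cases hwM : w ∈ M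
  · have := h.le_defect_of_mem_lines hLM hwL hwM
    nlinarith
  · have := (abs_le.1 (le_refl |G.defect s t x w|)).1
    have := h.abs_defect_le hs ht hLM hwL hwM
    linarith
  · have := (abs_le.1 (le_refl |G.defect s t x w|)).1
    have := h.abs_defect_le hs ht hLM.symm hwM hwL
    linarith
  · simp_all

/-- A neighbour `y` of `x` off the lines through `x` has defect near `-s t`. Taking `z` on a line
through `x` with no such neighbours of `x` around it, the defects of `y` sum to zero over the
common neighbours of `y` and `z`, but only the term of `x` is large. -/
lemma IsGridLike.closedNbhd_eq_union (h : G.IsGridLike s t) (hs : 2 ≤ s)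
    (ht : 132 * (s + 1) ^ 2 ≤ t) {x : V} {L M : Finset V} (hLM : G.IsLinePair s t x L M) :
    G.closedNbhd x = L ∪ M := by
  obtain ⟨hs', ht', ht''⟩ := real_bounds hs ht
  refine Subset.antisymm (fun y hy => ?_)
    (union_subset (hLM.left.subset hLM.mem_left) (hLM.right.subset hLM.mem_right))
  by_contra hyLM
  have hyl : y ∈ G.closedNbhd x \ (L ∪ M) := mem_sdiff.2 ⟨hy, hyLM⟩
  have hxy := h.defect_le_of_notMem_lines hLM hy
    (fun H => hyLM (mem_union_left _ H)) (fun H => hyLM (mem_union_right _ H))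
  -- At most `18 s` neighbours are off the lines, each adjacent to at most `2 s` vertices of `L`.
  obtain ⟨z, hzL, hz⟩ : ∃ z ∈ L, ∀ l ∈ G.closedNbhd x \ (L ∪ M), z ∉ G.closedNbhd l := by
    by_contra! H
    have h1 : L ⊆ (G.closedNbhd x \ (L ∪ M)).biUnion fun l => G.closedNbhd l ∩ L := by
      intro z hz
      obtain ⟨l, hl, hzl⟩ := H z hz
      exact mem_biUnion.2 ⟨l, hl, mem_inter.2 ⟨hzl, hz⟩⟩
    have h2 := (card_le_card h1).trans (card_biUnion_le_card_mul _ _ (2 * s) fun l hl =>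
      h.card_inter_line_le hLM.left fun H => (mem_sdiff.1 hl).2 (mem_union_left _ H))
    have h3 := h2.trans (Nat.mul_le_mul_right _ hLM.card_le)
    have h4 : s * t ≤ s * (72 * s) := by
      have := hLM.left.2
      nlinarith
    have h5 := Nat.le_of_mul_le_mul_left h4 (by omega)
    nlinarith
  have hzx : z ∈ G.closedNbhd x := hLM.left.subset hLM.mem_left hzL
  have hzy : y ∉ G.closedNbhd z := fun H => hz y hyl (mem_closedNbhd_comm.1 H)
  have hsum := h.sum_inter z y
  rw [if_neg hzy] at hsum
  have hx : x ∈ G.closedNbhd z ∩ G.closedNbhd y :=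
    mem_inter.2 ⟨mem_closedNbhd_comm.1 hzx, mem_closedNbhd_comm.1 hy⟩
  rw [← add_sum_erase _ _ hx] at hsum
  have hcard : #((G.closedNbhd z ∩ G.closedNbhd y).erase x) ≤ 2 * s :=
    card_erase_le.trans (h.card_inter_le hzy)
  -- The other terms are not large and positive: a value near `s t` at `w`
  -- would put `w`, a neighbour of `z`, off the lines through `x`.
  have hle : ∀ w ∈ (G.closedNbhd z ∩ G.closedNbhd y).erase x, G.defect s t w y ≤ t / 5 := by
    intro w hw
    obtain ⟨-, hw⟩ := mem_erase.1 hw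
    obtain ⟨hwz, hwy⟩ := mem_inter.1 hw
    obtain ⟨L', M', hLM'⟩ := h.exists_linePair hs (hundred_le_of_bound hs ht) y
    rw [defect_comm]
    by_cases hwL : w ∈ L' <;> by_cases hwM : w ∈ M'
    · have h1 := h.le_defect_of_mem_lines hLM' hwL hwM
      rw [defect_comm] at h1
      have h2 := h.notMem_lines_of_defect hs ht hLM hxy h1
      exact absurd (mem_closedNbhd_comm.1 hwz) (hz w h2)
    · have := le_abs_self (G.defect s t y w)
      have := h.abs_defect_le hs ht hLM' hwL hwM
      linarith
    · have := le_abs_self (G.defect s t y w)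
      have := h.abs_defect_le hs ht hLM'.symm hwM hwL
      linarith
    · have := h.defect_le_of_notMem_lines hLM' hwy hwL hwM
      nlinarith
  have h1 := sum_le_card_nsmul _ _ _ hle
  rw [nsmul_eq_mul] at h1
  have h2 : (#((G.closedNbhd z ∩ G.closedNbhd y).erase x) : ℝ) * (t / 5) ≤ 2 * s * (t / 5) :=
    mul_le_mul_of_nonneg_right (by exact_mod_cast hcard) (by positivity)
  nlinarith

/-! ### The incidence structure of vertices and lines -/

/-- The closed neighbourhood of each vertex of the intersection of two lines is their union. -/
lemma IsGridLike.closedNbhd_eq_union_of_lines (h : G.IsGridLike s t) (hs : 2 ≤ s)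
    (ht : 132 * (s + 1) ^ 2 ≤ t) {x : V} {L M : Finset V} (hL : G.IsLine s t L)
    (hM : G.IsLine s t M) (hne : L ≠ M) (hxL : x ∈ L) (hxM : x ∈ M) :
    G.IsLinePair s t x L M ∧ G.closedNbhd x = L ∪ M := by
  obtain ⟨K, N, hKN⟩ := h.exists_linePair hs (hundred_le_of_bound hs ht) x
  have h1 := h.eq_or_eq_of_linePair hs (hundred_le_of_bound hs ht) hKN hL hxL
  have h2 := h.eq_or_eq_of_linePair hs (hundred_le_of_bound hs ht) hKN hM hxM
  have h3 : G.IsLinePair s t x L M := by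
    rcases h1 with rfl | rfl <;> rcases h2 with rfl | rfl
    · exact absurd rfl hne
    · exact hKN
    · exact hKN.symm
    · exact absurd rfl hne
  exact ⟨h3, h.closedNbhd_eq_union hs ht h3⟩

/-- Vertices on both lines through `x` are twins of `x`. -/
lemma IsGridLike.defect_eq_of_mem (h : G.IsGridLike s t) (hs : 2 ≤ s)
    (ht : 132 * (s + 1) ^ 2 ≤ t) {x y : V} {L M : Finset V} (hLM : G.IsLinePair s t x L M)
    (hyL : y ∈ L) (hyM : y ∈ M) : G.defect s t x y = s * t := by
  have h1 := h.closedNbhd_eq_union hs ht hLM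
  obtain ⟨-, h2⟩ := h.closedNbhd_eq_union_of_lines hs ht hLM.left hLM.right hLM.ne hyL hyM
  rw [defect_of_mem (h1 ▸ mem_union_left _ hyL), h2, ← h1, inter_self, h.cast_card]
  ring

/-- The sum of the defects along a line through `x`. -/
lemma IsGridLike.abs_sum_line_le (h : G.IsGridLike s t) (hs : 2 ≤ s)
    (ht : 132 * (s + 1) ^ 2 ≤ t) {x : V} {L M : Finset V} (hLM : G.IsLinePair s t x L M) :
    5 * |(s : ℝ) ^ 2 * t - #(L ∩ M) * (s * t) - ∑ w ∈ L \ M, G.defect s t x w| ≤ 2 * s * t := by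
  obtain ⟨z, hzL, hzM⟩ := hLM.left.exists_notMem hLM.right hLM.ne
  have hx := h.closedNbhd_eq_union hs ht hLM
  have hzx : z ∈ G.closedNbhd x := hLM.left.subset hLM.mem_left hzL
  have h1 := h.sum_inter z x
  rw [if_pos (mem_closedNbhd_comm.1 hzx)] at h1
  have h2 : G.closedNbhd z ∩ G.closedNbhd x =
      (L ∩ M) ∪ (L \ M) ∪ (G.closedNbhd z ∩ (M \ L)) := by
    ext w
    have : w ∈ L → w ∈ G.closedNbhd z := fun H => hLM.left.subset hzL H
    simp only [hx, mem_inter, mem_union, mem_sdiff]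
    tauto
  have hd1 : Disjoint (L ∩ M) (L \ M) := (disjoint_sdiff_inter L M).symm
  have hd2 : Disjoint ((L ∩ M) ∪ (L \ M)) (G.closedNbhd z ∩ (M \ L)) := by
    rw [Finset.disjoint_left]
    intro w hw hw'
    simp only [mem_inter, mem_union, mem_sdiff] at hw hw'
    tauto
  rw [h2, sum_union hd2, sum_union hd1] at h1
  have h3 : ∑ w ∈ L ∩ M, G.defect s t w x = #(L ∩ M) * (s * t) := by
    rw [sum_congr rfl fun w hw => by
      rw [defect_comm, h.defect_eq_of_mem hs ht hLM (mem_inter.1 hw).1 (mem_inter.1 hw).2]]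
    rw [sum_const, nsmul_eq_mul]
  have h4 : ∑ w ∈ L \ M, G.defect s t w x = ∑ w ∈ L \ M, G.defect s t x w :=
    sum_congr rfl fun w _ => defect_comm w x
  have h5 : |∑ w ∈ G.closedNbhd z ∩ (M \ L), G.defect s t w x| ≤ 2 * s * (t / 5) := by
    refine (abs_sum_le_sum_abs _ _).trans ((sum_le_card_nsmul _ _ (t / 5 : ℝ) ?_).trans ?_)
    · intro w hw
      obtain ⟨hwM, hwL⟩ := mem_sdiff.1 (mem_inter.1 hw).2
      have := h.abs_defect_le hs ht hLM.symm hwM hwL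
      rw [defect_comm]
      linarith
    · rw [nsmul_eq_mul]
      refine mul_le_mul_of_nonneg_right ?_ (by positivity)
      exact_mod_cast (card_le_card (inter_subset_inter_left sdiff_subset)).trans
        (h.card_inter_line_le hLM.right hzM)
  rw [show (s : ℝ) ^ 2 * t - #(L ∩ M) * (s * t) - ∑ w ∈ L \ M, G.defect s t x w =
    ∑ w ∈ G.closedNbhd z ∩ (M \ L), G.defect s t w x by linarith]
  linarith

lemma IsGridLike.sum_eq_of_linePair (h : G.IsGridLike s t) (hs : 2 ≤ s)
    (ht : 132 * (s + 1) ^ 2 ≤ t) {x : V} {L M : Finset V} (hLM : G.IsLinePair s t x L M)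
    (f : ℝ → ℝ) (hf : f 0 = 0) :
    ∑ y, f (G.defect s t x y) = #(L ∩ M) * f (s * t) +
      ∑ y ∈ L \ M, f (G.defect s t x y) + ∑ y ∈ M \ L, f (G.defect s t x y) := by
  have hx := h.closedNbhd_eq_union hs ht hLM
  have h1 : ∑ y, f (G.defect s t x y) = ∑ y ∈ L ∪ M, f (G.defect s t x y) := by
    refine (sum_subset (subset_univ _) fun y _ hy => ?_).symm
    rw [defect_of_notMem (hx ▸ hy), hf]
  have h2 : L ∪ M = (L ∩ M) ∪ (L \ M) ∪ (M \ L) := by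
    ext w
    simp only [mem_inter, mem_union, mem_sdiff]
    tauto
  have hd1 : Disjoint (L ∩ M) (L \ M) := (disjoint_sdiff_inter L M).symm
  have hd2 : Disjoint ((L ∩ M) ∪ (L \ M)) (M \ L) := by
    rw [Finset.disjoint_left]
    intro w hw hw'
    simp only [mem_inter, mem_union, mem_sdiff] at hw hw'
    tauto
  rw [h1, h2, sum_union hd2, sum_union hd1]
  congr 2
  rw [sum_congr rfl fun w hw => by
      rw [h.defect_eq_of_mem hs ht hLM (mem_inter.1 hw).1 (mem_inter.1 hw).2]]
  rw [sum_const, nsmul_eq_mul]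

/-- Two distinct lines that meet have `s` common points: the sums of the defects along the two
lines add up to the total sum of the defects at a common point. -/
lemma IsGridLike.card_inter_lines (h : G.IsGridLike s t) (hs : 2 ≤ s)
    (ht : 132 * (s + 1) ^ 2 ≤ t) {x : V} {L M : Finset V} (hLM : G.IsLinePair s t x L M) :
    #(L ∩ M) = s := by
  obtain ⟨hs', ht', ht''⟩ := real_bounds hs ht
  have h1 := h.abs_sum_line_le hs ht hLM
  have h2 := h.abs_sum_line_le hs ht hLM.symm
  rw [inter_comm M L] at h2
  have h3 := h.sum_eq_of_linePair hs ht hLM id rfl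
  have h4 := h.sum_defect x
  simp only [id, defect_comm x] at h1 h2 h3
  rw [h4] at h3
  have h5 := abs_le.1 (show |_| ≤ (2 * s * t / 5 : ℝ) from (le_div_iff₀' (by norm_num)).2 h1)
  have h6 := abs_le.1 (show |_| ≤ (2 * s * t / 5 : ℝ) from (le_div_iff₀' (by norm_num)).2 h2)
  have hst : (0 : ℝ) < s * t := by nlinarith
  have h7 : (s * t : ℝ) * s < s * t * (#(L ∩ M) + 1) := by linarith
  have h8 : (s * t : ℝ) * #(L ∩ M) < s * t * (s + 1) := by linarith
  have h7 := lt_of_mul_lt_mul_left h7 hst.le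
  have h8 := lt_of_mul_lt_mul_left h8 hst.le
  norm_cast at h7 h8
  omega

lemma IsGridLike.defect_eq_zero (h : G.IsGridLike s t) (hs : 2 ≤ s)
    (ht : 132 * (s + 1) ^ 2 ≤ t) {x y : V} {L M : Finset V} (hLM : G.IsLinePair s t x L M)
    (hyL : y ∈ L) (hyM : y ∉ M) : G.defect s t x y = 0 := by
  have h1 := h.sum_eq_of_linePair hs ht hLM (fun r => r ^ 2) (by norm_num)
  rw [h.sum_sq, h.card_inter_lines hs ht hLM] at h1
  have h2 : 0 ≤ ∑ y ∈ M \ L, G.defect s t x y ^ 2 := sum_nonneg fun _ _ => sq_nonneg _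
  have h3 : ∑ y ∈ L \ M, G.defect s t x y ^ 2 ≤ 0 := by linarith
  have h4 := single_le_sum (f := fun y => G.defect s t x y ^ 2)
    (fun _ _ => sq_nonneg _) (mem_sdiff.2 ⟨hyL, hyM⟩)
  exact pow_eq_zero_iff (two_ne_zero) |>.1 (le_antisymm (h4.trans h3) (sq_nonneg _))

/-- A line through `x` has `s (t + 1)` vertices, and there are no edges between the two lines
through `x`, apart from those at their common points. -/
lemma IsGridLike.card_line_and_not_adj (h : G.IsGridLike s t) (hs : 2 ≤ s)
    (ht : 132 * (s + 1) ^ 2 ≤ t) {x : V} {L M : Finset V} (hLM : G.IsLinePair s t x L M) :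
    #L = s * (t + 1) ∧ ∀ y ∈ L, y ∉ M → ∀ z ∈ M, z ∉ L → z ∉ G.closedNbhd y := by
  have hx := h.closedNbhd_eq_union hs ht hLM
  have key : ∀ {L M : Finset V}, G.IsLinePair s t x L M → ∀ y ∈ L, y ∉ M →
      #(G.closedNbhd x ∩ G.closedNbhd y) = s * (t + 1) ∧
        L ⊆ G.closedNbhd x ∩ G.closedNbhd y := by
    intro L M hLM y hyL hyM
    have h1 := h.defect_eq_zero hs ht hLM hyL hyM
    rw [defect_of_mem (hLM.left.subset hLM.mem_left hyL), sub_eq_zero] at h1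
    exact ⟨by exact_mod_cast h1,
      subset_inter (hLM.left.subset hLM.mem_left) (hLM.left.subset hyL)⟩
  have h1 : #L ≤ s * (t + 1) := by
    obtain ⟨y, hyL, hyM⟩ := hLM.left.exists_notMem hLM.right hLM.ne
    obtain ⟨h1, h2⟩ := key hLM y hyL hyM
    exact h1 ▸ card_le_card h2
  have h2 : #M ≤ s * (t + 1) := by
    obtain ⟨y, hyM, hyL⟩ := hLM.right.exists_notMem hLM.left hLM.ne.symm
    obtain ⟨h1, h2⟩ := key hLM.symm y hyM hyL
    exact h1 ▸ card_le_card h2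
  have h3 := card_union_add_card_inter L M
  rw [← hx, h.card_closedNbhd, h.card_inter_lines hs ht hLM] at h3
  have h4 : #L = s * (t + 1) := by
    have : s * (2 * t + 1) + s = 2 * (s * (t + 1)) := by ring
    omega
  refine ⟨h4, fun y hyL hyM z hzM hzL hyz => hzL ?_⟩
  obtain ⟨h5, h6⟩ := key hLM y hyL hyM
  rw [eq_of_subset_of_card_le h6 (by rw [h4, h5])]
  exact mem_inter.2 ⟨hLM.right.subset hLM.mem_right hzM, hyz⟩


/-! ### Rows and columns -/

lemma IsGridLike.exists_linePair_left (h : G.IsGridLike s t) (hs : 2 ≤ s)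
    (ht : 132 * (s + 1) ^ 2 ≤ t) {v : V} {K : Finset V} (hK : G.IsLine s t K) (hv : v ∈ K) :
    ∃ W, G.IsLinePair s t v K W := by
  obtain ⟨K', N', hp⟩ := h.exists_linePair hs (hundred_le_of_bound hs ht) v
  rcases h.eq_or_eq_of_linePair hs (hundred_le_of_bound hs ht) hp hK hv with rfl | rfl
  · exact ⟨_, hp⟩
  · exact ⟨_, hp.symm⟩

/-- Lines form no triangles: of the two lines through `u` at most one meets a line off `u`. -/
lemma IsGridLike.disjoint_of_not_disjoint (h : G.IsGridLike s t) (hs : 2 ≤ s)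
    (ht : 132 * (s + 1) ^ 2 ≤ t) {u : V} {U₁ U₂ K : Finset V} (hU : G.IsLinePair s t u U₁ U₂)
    (hK : G.IsLine s t K) (hu : u ∉ K) (hd : ¬ Disjoint U₁ K) : Disjoint U₂ K := by
  by_contra hd'
  obtain ⟨a, ha₁, haK⟩ := not_disjoint_iff.1 hd
  obtain ⟨b, hb₂, hbK⟩ := not_disjoint_iff.1 hd'
  have key : ∀ c ∈ U₁, c ∈ U₂ → c ∉ K := by
    intro c hc₁ hc₂ hcK
    obtain ⟨hc, -⟩ := h.closedNbhd_eq_union_of_lines hs ht hU.left hU.right hU.ne hc₁ hc₂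
    rcases h.eq_or_eq_of_linePair hs (hundred_le_of_bound hs ht) hc hK hcK with rfl | rfl
    exacts [hu hU.mem_left, hu hU.mem_right]
  exact (h.card_line_and_not_adj hs ht hU).2 a ha₁ (fun H => key a ha₁ H haK) b hb₂
    (fun H => key b H hb₂ hbK) (hK.subset haK hbK)

lemma IsGridLike.card_inter_lines_le (h : G.IsGridLike s t) (hs : 2 ≤ s)
    (ht : 132 * (s + 1) ^ 2 ≤ t) {L M : Finset V} (hL : G.IsLine s t L) (hM : G.IsLine s t M)
    (hne : L ≠ M) : #(L ∩ M) ≤ s := by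
  rcases (L ∩ M).eq_empty_or_nonempty with h0 | ⟨x, hx⟩
  · simp [h0]
  · rw [mem_inter] at hx
    exact (h.card_inter_lines hs ht
      (h.closedNbhd_eq_union_of_lines hs ht hL hM hne hx.1 hx.2).1).le

/-- One of the lines through `u` meets a given line `K` off `u`: the `2s` common neighbours of `u`
and a non-adjacent vertex of `K` lie on the intersections of their lines. -/
lemma IsGridLike.not_disjoint_or (h : G.IsGridLike s t) (hs : 2 ≤ s)
    (ht : 132 * (s + 1) ^ 2 ≤ t) {u : V} {U₁ U₂ K : Finset V} (hU : G.IsLinePair s t u U₁ U₂)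
    (hK : G.IsLine s t K) (hu : u ∉ K) : ¬ Disjoint U₁ K ∨ ¬ Disjoint U₂ K := by
  by_contra! H
  obtain ⟨v, hv, huv⟩ : ∃ v ∈ K, u ∉ G.closedNbhd v := by
    have := (hK.1 u).not.1 hu
    push Not at this
    exact this
  obtain ⟨W, hW⟩ := h.exists_linePair_left hs ht hK hv
  have huW : u ∉ W := fun H => huv (hW.right.subset hW.mem_right H)
  have h1 := h.card_inter v u huv
  have h2 : G.closedNbhd v ∩ G.closedNbhd u ⊆ (U₁ ∩ W) ∪ (U₂ ∩ W) := by
    rw [h.closedNbhd_eq_union hs ht hW, h.closedNbhd_eq_union hs ht hU]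
    intro w hw
    have h3 : w ∈ U₁ → w ∉ K := fun h3 => Finset.disjoint_left.1 H.1 h3
    have h4 : w ∈ U₂ → w ∉ K := fun h3 => Finset.disjoint_left.1 H.2 h3
    simp only [mem_inter, mem_union] at hw ⊢
    tauto
  have h3 := (card_le_card h2).trans (card_union_le _ _)
  have h4 := h.card_inter_lines_le hs ht hU.left hW.right (fun e => huW (e ▸ hU.mem_left))
  have h5 := h.card_inter_lines_le hs ht hU.right hW.right (fun e => huW (e ▸ hU.mem_right))
  by_cases hd : Disjoint U₁ W
  · rw [disjoint_iff_inter_eq_empty.1 hd, card_empty] at h3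
    omega
  · have hd := h.disjoint_of_not_disjoint hs ht hU hW.right huW hd
    rw [disjoint_iff_inter_eq_empty.1 hd, card_empty] at h3
    omega

/-- Through each vertex there is a line that equals or avoids the line `R` (the row of the vertex)
and one that crosses `R` (its column). -/
lemma IsGridLike.exists_row_col (h : G.IsGridLike s t) (hs : 2 ≤ s)
    (ht : 132 * (s + 1) ^ 2 ≤ t) {R : Finset V} (hR : G.IsLine s t R) (u : V) :
    ∃ K C, G.IsLinePair s t u K C ∧ (K = R ∨ Disjoint K R) ∧ C ≠ R ∧ ¬ Disjoint C R := by
  by_cases hu : u ∈ R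
  · obtain ⟨W, hW⟩ := h.exists_linePair_left hs ht hR hu
    exact ⟨R, W, hW, Or.inl rfl, hW.ne.symm, not_disjoint_iff.2 ⟨u, hW.mem_right, hu⟩⟩
  · obtain ⟨U₁, U₂, hU⟩ := h.exists_linePair hs (hundred_le_of_bound hs ht) u
    rcases h.not_disjoint_or hs ht hU hR hu with hd | hd
    · exact ⟨U₂, U₁, hU.symm, Or.inr (h.disjoint_of_not_disjoint hs ht hU hR hu hd),
        fun e => hu (e ▸ hU.mem_left), hd⟩
    · exact ⟨U₁, U₂, hU, Or.inr (h.disjoint_of_not_disjoint hs ht hU.symm hR hu hd),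
        fun e => hu (e ▸ hU.mem_right), hd⟩

/-- Coordinates in which adjacency is that of the clique extension of the grid. -/
lemma nonempty_iso_of_coordinates {W : Type*} [Fintype W] {H : SimpleGraph W} {n : ℕ}
    (f g : W → Fin n)
    (hfib : ∀ i j, #{v | f v = i ∧ g v = j} = s)
    (hadj : ∀ u v, H.Adj u v ↔ u ≠ v ∧ (f u = f v ∨ g u = g v)) :
    Nonempty (H ≃g (squareGrid n).cliqueExtension s) := by
  let F : W → Fin n × Fin n := fun v => (f v, g v)
  have hcard : ∀ p, Fintype.card {v // F v = p} = s := by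
    intro p
    rw [Fintype.card_subtype, ← hfib p.1 p.2]
    simp [F, Prod.ext_iff]
  let φ : W ≃ (Fin n × Fin n) × Fin s := (Equiv.sigmaFiberEquiv F).symm.trans
    ((Equiv.sigmaCongrRight fun p => Fintype.equivFinOfCardEq (hcard p)).trans
      (Equiv.sigmaEquivProd _ _))
  have hφ : ∀ v, (φ v).1 = (f v, g v) := fun v => rfl
  refine ⟨⟨φ, fun {u v} => ?_⟩⟩
  have h2 : u = v ↔ (f u = f v ∧ g u = g v) ∧ (φ u).2 = (φ v).2 := by
    rw [← φ.apply_eq_iff_eq, Prod.ext_iff, hφ, hφ, Prod.mk.injEq]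
  simp only [cliqueExtension, hφ, squareGrid, boxProd_adj, top_adj, Prod.mk.injEq, hadj, ne_eq, h2]
  tauto

/-- A large grid-like graph is a clique extension of the grid. -/
theorem IsGridLike.nonempty_iso (h : G.IsGridLike s t) (hs : 2 ≤ s)
    (ht : 132 * (s + 1) ^ 2 ≤ t) (hn : Fintype.card V = s * (t + 1) ^ 2) :
    Nonempty (G ≃g (squareGrid (t + 1)).cliqueExtension s) := by
  have : Nonempty V := by
    rw [← Fintype.card_pos_iff, hn]
    positivity
  obtain ⟨x₀⟩ := this
  obtain ⟨R, _, hR⟩ := h.exists_linePair hs (hundred_le_of_bound hs ht) x₀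
  choose row col hp hrow hcol using h.exists_row_col hs ht hR.left
  have row_eq : ∀ u v, v ∈ row u → row v = row u := by
    intro u v hv
    rcases h.eq_or_eq_of_linePair hs (hundred_le_of_bound hs ht) (hp v) (hp u).left hv with e | e
    · exact e.symm
    · rcases hrow u with h1 | h1
      · exact absurd (e ▸ h1) (hcol v).1
      · exact absurd (e ▸ h1) (hcol v).2
  have col_eq : ∀ u v, v ∈ col u → col v = col u := by
    intro u v hv
    rcases h.eq_or_eq_of_linePair hs (hundred_le_of_bound hs ht) (hp v) (hp u).right hv with e | e
    · rcases hrow v with h1 | h1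
      · exact absurd (e.trans h1) (hcol u).1
      · exact absurd (e ▸ h1) (hcol u).2
    · exact e.symm
  have mem_row : ∀ u v, v ∈ row u ↔ row v = row u := fun u v =>
    ⟨row_eq u v, fun e => e ▸ (hp v).mem_left⟩
  have mem_col : ∀ u v, v ∈ col u ↔ col v = col u := fun u v =>
    ⟨col_eq u v, fun e => e ▸ (hp v).mem_right⟩
  have fib : ∀ u v, #{w | row w = row u ∧ col w = col v} = s := by
    intro u v
    obtain ⟨w, hwu, hwv⟩ : ∃ w, w ∈ row u ∧ w ∈ col v := by
      by_cases hv : v ∈ row u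
      · exact ⟨v, hv, (hp v).mem_right⟩
      · rcases h.not_disjoint_or hs ht (hp v) (hp u).left hv with hd | hd
        · obtain ⟨w, hw₁, hw₂⟩ := not_disjoint_iff.1 hd
          exact absurd ((mem_row u v).2 ((row_eq v w hw₁).symm.trans (row_eq u w hw₂))) hv
        · obtain ⟨w, hw₁, hw₂⟩ := not_disjoint_iff.1 hd
          exact ⟨w, hw₂, hw₁⟩
    rw [← h.card_inter_lines hs ht (hp w)]
    congr 1
    ext z
    simp [mem_row, mem_col, row_eq u w hwu, col_eq v w hwv]
  have hpos : 0 < s * (t + 1) := by positivity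
  have card_image : ∀ f : V → Finset V, (∀ u v, v ∈ f u ↔ f v = f u) →
      (∀ u, #(f u) = s * (t + 1)) → #(univ.image f) = t + 1 := by
    intro f hf hc
    have h1 := card_eq_sum_card_image f univ
    rw [card_univ, hn, sum_congr rfl (g := fun _ => s * (t + 1)), sum_const, smul_eq_mul] at h1
    · exact (Nat.eq_of_mul_eq_mul_right hpos (by rw [← h1]; ring)).symm
    · intro K hK
      obtain ⟨u, -, rfl⟩ := mem_image.1 hK
      rw [← hc u]
      congr 1
      ext v
      simp [hf]
  have card_row := card_image row mem_row fun u => (h.card_line_and_not_adj hs ht (hp u)).1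
  have card_col := card_image col mem_col fun u => (h.card_line_and_not_adj hs ht (hp u).symm).1
  let eR := Finset.equivFinOfCardEq card_row
  let eC := Finset.equivFinOfCardEq card_col
  refine nonempty_iso_of_coordinates
    (fun v => eR ⟨row v, mem_image_of_mem _ (mem_univ v)⟩)
    (fun v => eC ⟨col v, mem_image_of_mem _ (mem_univ v)⟩) ?_ ?_
  · intro i j
    obtain ⟨⟨K, hK⟩, rfl⟩ := eR.surjective i
    obtain ⟨⟨C, hC⟩, rfl⟩ := eC.surjective j
    obtain ⟨u, -, rfl⟩ := mem_image.1 hK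
    obtain ⟨v, -, rfl⟩ := mem_image.1 hC
    simpa using fib u v
  · intro u v
    have h1 : v ∈ G.closedNbhd u ↔ row u = row v ∨ col u = col v := by
      rw [h.closedNbhd_eq_union hs ht (hp u), mem_union, mem_row, mem_col, eq_comm,
        eq_comm (a := col v)]
    simp only [EmbeddingLike.apply_eq_iff_eq, Subtype.mk.injEq, ← h1, mem_closedNbhd]
    constructor
    · exact fun h => ⟨h.ne, Or.inr h⟩
    · rintro ⟨h1, h2 | h2⟩
      exacts [absurd h2.symm h1, h2]

end SimpleGraph

/-! ### Traces of polynomials in a symmetric matrix -/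

lemma Matrix.IsHermitian.trace_aeval {n : Type*} [Fintype n] [DecidableEq n] {A : Matrix n n ℝ}
    (hA : A.IsHermitian) (p : Polynomial ℝ) :
    (Polynomial.aeval A p).trace = (A.charpoly.roots.map fun r => p.eval r).sum := by
  have h1 : Polynomial.aeval A p = Unitary.conjStarAlgAut ℝ _ hA.eigenvectorUnitary
      (diagonal fun i => p.eval (hA.eigenvalues i)) := by
    conv_lhs => rw [hA.spectral_theorem]
    rw [Polynomial.aeval_algHom_apply (F := Matrix n n ℝ ≃⋆ₐ[ℝ] Matrix n n ℝ)]
    congr 1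
    exact (Polynomial.aeval_algHom_apply (diagonalAlgHom ℝ) (RCLike.ofReal ∘ hA.eigenvalues) p).trans
      (congrArg diagonal (by ext i; simp))
  rw [h1, Unitary.conjStarAlgAut_apply, trace_mul_comm, ← mul_assoc, hA.roots_charpoly_eq_eigenvalues]
  simp [trace]

lemma sum_map_gridExtensionSpectrum (s t : ℕ) (hs : 1 ≤ s) (f : ℝ → ℝ) :
    ((gridExtensionSpectrum s t).map f).sum = f (s * (2 * t + 1) - 1) + 2 * t * f (s * t - 1) +
      (s - 1) * (t + 1) ^ 2 * f (-1) + t ^ 2 * f (-s - 1) := by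
  simp [gridExtensionSpectrum, Nat.cast_sub hs, add_assoc]

namespace SimpleGraph

variable {V : Type*} [Fintype V] [DecidableEq V]
variable {G : SimpleGraph V} [DecidableRel G.Adj] {s t : ℕ}

/-! ### From the spectrum to the matrix of defects -/

open Matrix in
lemma trace_aeval_adjMatrix (p : Polynomial ℝ) : (Polynomial.aeval (G.adjMatrix ℝ) p).trace =
    (G.adjSpectrum.map fun r => p.eval r).sum := by
  have : (G.adjMatrix ℝ).IsHermitian := by
    rw [IsHermitian, conjTranspose_eq_transpose_of_trivial, transpose_adjMatrix]
  exact this.trace_aeval p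

lemma card_of_adjSpectrum (hs : 2 ≤ s) (hG : G.adjSpectrum = gridExtensionSpectrum s t) :
    Fintype.card V = s * (t + 1) ^ 2 := by
  have h := trace_aeval_adjMatrix (G := G) 1
  rw [hG, sum_map_gridExtensionSpectrum s t (by omega)] at h
  simp only [map_one, Matrix.trace_one, Polynomial.eval_one] at h
  have : (Fintype.card V : ℝ) = s * (t + 1) ^ 2 := by rw [h]; ring
  exact_mod_cast this

lemma degree_of_adjSpectrum (hs : 2 ≤ s) (hG : G.adjSpectrum = gridExtensionSpectrum s t) {k : ℕ}
    (hk : G.IsRegularOfDegree k) : (k : ℝ) = s * (2 * t + 1) - 1 := by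
  have h := trace_aeval_adjMatrix (G := G) (Polynomial.X ^ 2)
  rw [hG, sum_map_gridExtensionSpectrum s t (by omega)] at h
  have h1 : (G.adjMatrix ℝ ^ 2).trace = s * (t + 1) ^ 2 * k := by
    rw [sq, Matrix.trace]
    simp only [Matrix.diag_apply, adjMatrix_mul_self_apply_self, hk.degree_eq, sum_const,
      card_univ, card_of_adjSpectrum hs hG]
    simp
  simp only [map_pow, Polynomial.aeval_X, Polynomial.eval_pow, Polynomial.eval_X, h1] at h
  have hs' : (2 : ℝ) ≤ s := by exact_mod_cast hs
  have h2 : (0 : ℝ) < s * (t + 1) ^ 2 := by positivity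
  refine mul_left_cancel₀ h2.ne' (h.trans ?_)
  ring

/-- The number of common neighbours of non-adjacent vertices, from counting closed walks of
length three. -/
lemma mu_of_adjSpectrum (hs : 2 ≤ s) (ht : 1 ≤ t)
    (hG : G.adjSpectrum = gridExtensionSpectrum s t) {k μ : ℕ} (hk : G.IsRegularOfDegree k)
    (hμ : ∀ x y : V, x ≠ y → ¬ G.Adj x y → Fintype.card (G.commonNeighbors x y) = μ) :
    μ = 2 * s := by
  have hs' : (2 : ℝ) ≤ s := by exact_mod_cast hs
  have ht' : (1 : ℝ) ≤ t := by exact_mod_cast ht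
  have hk' := degree_of_adjSpectrum hs hG hk
  have hn := card_of_adjSpectrum hs hG
  have h := trace_aeval_adjMatrix (G := G) (Polynomial.X ^ 3)
  rw [hG, sum_map_gridExtensionSpectrum s t (by omega)] at h
  simp only [map_pow, Polynomial.aeval_X, Polynomial.eval_pow, Polynomial.eval_X] at h
  have hA2 : ∀ x y, (G.adjMatrix ℝ * G.adjMatrix ℝ) x y =
      Fintype.card (G.commonNeighbors x y) := by
    intro x y
    rw [adjMatrix_mul_apply, ← Set.toFinset_card]
    simp only [adjMatrix_apply, sum_boole]
    congr 2
    ext z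
    simp [mem_commonNeighbors, G.adj_comm y]
  have hrow : ∀ x, ∑ y, G.adjMatrix ℝ x y = k := by
    intro x
    rw [← hk.degree_eq x, ← card_neighborFinset_eq_degree, neighborFinset_eq_filter]
    simp [adjMatrix_apply]
  have hcol : ∀ x, ∑ y, G.adjMatrix ℝ y x = k := by
    intro x
    simpa [adjMatrix_apply, G.adj_comm] using hrow x
  have h3 : ∀ x, ∑ y, (G.adjMatrix ℝ * G.adjMatrix ℝ) x y = k * k := by
    intro x
    simp only [Matrix.mul_apply]
    rw [sum_comm]
    simp only [← mul_sum, hrow, ← sum_mul]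
  have h4 : ∀ x, ∑ y, (G.adjMatrix ℝ * G.adjMatrix ℝ) x y * G.adjMatrix ℝ y x =
      k * k - k - μ * (s * (t + 1) ^ 2 - 1 - k) := by
    intro x
    -- Off the diagonal and the edges, that is, on the support of `J - A - 1`, `A²` equals `μ`.
    have h5 : ∀ y, (G.adjMatrix ℝ * G.adjMatrix ℝ) x y * (1 - G.adjMatrix ℝ y x -
        (1 : Matrix V V ℝ) x y) = μ * (1 - G.adjMatrix ℝ y x - (1 : Matrix V V ℝ) x y) := by
      intro y
      by_cases hxy : x = y
      · subst hxy; simp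
      · by_cases ha : G.Adj x y
        · simp [hxy, adjMatrix_apply, ha.symm]
        · rw [hA2, hμ x y hxy ha]
    have h6 := sum_congr (rfl : (univ : Finset V) = univ) fun y _ => h5 y
    rw [← mul_sum] at h6
    simp only [mul_sub, sum_sub_distrib, mul_one, h3, hcol, Matrix.one_apply, mul_ite, mul_zero,
      sum_ite_eq, mem_univ, if_true, sum_const, card_univ, hn, adjMatrix_mul_self_apply_self,
      hk.degree_eq] at h6
    push_cast [nsmul_eq_mul] at h6
    linarith
  have h5 : (G.adjMatrix ℝ ^ 3).trace =
      s * (t + 1) ^ 2 * (k * k - k - μ * (s * (t + 1) ^ 2 - 1 - k)) := by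
    rw [pow_succ, sq, Matrix.trace]
    have h6 : ∀ x, (G.adjMatrix ℝ * G.adjMatrix ℝ * G.adjMatrix ℝ) x x = _ := fun x =>
      (Matrix.mul_apply ..).trans (h4 x)
    simp only [Matrix.diag_apply, h6, sum_const, card_univ, hn]
    push_cast [nsmul_eq_mul]
    ring
  rw [h5, hk'] at h
  have h6 : (s * (t + 1) ^ 2 * (s * t ^ 2) : ℝ) * μ = (s * (t + 1) ^ 2 * (s * t ^ 2)) * (2 * s) := by
    linear_combination -h
  have h7 := mul_left_cancel₀ (by positivity) h6
  exact_mod_cast h7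

/-- The all-ones matrix. -/
def allOnes (n : Type*) : Matrix n n ℝ := Matrix.of fun _ _ => 1

section

variable {W : Type*} [Fintype W] {H : SimpleGraph W} [DecidableRel H.Adj]

lemma adjMatrix_mul_allOnes {k : ℕ} (hk : H.IsRegularOfDegree k) :
    H.adjMatrix ℝ * allOnes W = (k : ℝ) • allOnes W := by
  ext x y
  simp [adjMatrix_mul_apply, allOnes, hk.degree_eq]

lemma allOnes_mul_adjMatrix {k : ℕ} (hk : H.IsRegularOfDegree k) :
    allOnes W * H.adjMatrix ℝ = (k : ℝ) • allOnes W := by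
  ext x y
  simp [mul_adjMatrix_apply, allOnes, hk.degree_eq]

lemma allOnes_mul_allOnes : allOnes W * allOnes W = (Fintype.card W : ℝ) • allOnes W := by
  ext x y
  simp [allOnes, Matrix.mul_apply]

end

lemma adjMatrix_add_one_apply (x y : V) :
    (G.adjMatrix ℝ + 1) x y = if y ∈ G.closedNbhd x then 1 else 0 := by
  by_cases hxy : x = y
  · subst hxy; simp [self_mem_closedNbhd]
  · simp [adjMatrix_apply, mem_closedNbhd, hxy, Ne.symm hxy]

/-- The Hoffman polynomial identity. The polynomial `q` that vanishes at all the eigenvalues but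
the valency satisfies `q(A) = c J`, because `q(A) - c J` is symmetric and its square has trace
zero. -/
lemma cubic_of_adjSpectrum (hs : 2 ≤ s) (hG : G.adjSpectrum = gridExtensionSpectrum s t)
    {k : ℕ} (hk : G.IsRegularOfDegree k) :
    (G.adjMatrix ℝ + 1) * (G.adjMatrix ℝ + 1) * (G.adjMatrix ℝ + 1) =
      (2 * s ^ 2 * (2 * t + 1) : ℝ) • allOnes V +
      (s * (t - 1) : ℝ) • ((G.adjMatrix ℝ + 1) * (G.adjMatrix ℝ + 1)) +
      (s ^ 2 * t : ℝ) • (G.adjMatrix ℝ + 1) := by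
  have hk' := degree_of_adjSpectrum hs hG hk
  have hn := card_of_adjSpectrum hs hG
  set A := G.adjMatrix ℝ with hA
  set J := allOnes V with hJ
  set B := A + 1 with hB
  have hBJ : B * J = (s * (2 * t + 1) : ℝ) • J := by
    rw [hB, add_mul, adjMatrix_mul_allOnes hk, hk', one_mul]
    module
  have hJB : J * B = (s * (2 * t + 1) : ℝ) • J := by
    rw [hB, mul_add, allOnes_mul_adjMatrix hk, hk', mul_one]
    module
  have hJJ : J * J = (s * (t + 1) ^ 2 : ℝ) • J := by
    rw [hJ, allOnes_mul_allOnes, hn]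
    push_cast
    rfl
  have hBt : B.transpose = B := by
    rw [hB, Matrix.transpose_add, transpose_adjMatrix, Matrix.transpose_one]
  have hJt : J.transpose = J := rfl
  have hJtr : J.trace = s * (t + 1) ^ 2 := by
    simp [hJ, allOnes, Matrix.trace, hn]
  set Q := B * B * B - (s * (t - 1) : ℝ) • (B * B) - (s ^ 2 * t : ℝ) • B with hQ
  set c : ℝ := 2 * s ^ 2 * (2 * t + 1) with hc
  let q : Polynomial ℝ := (Polynomial.X + 1) ^ 3 - (s * (t - 1) : ℝ) • (Polynomial.X + 1) ^ 2 -
    (s ^ 2 * t : ℝ) • (Polynomial.X + 1)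
  have hqQ : Polynomial.aeval A q = Q := by
    simp only [q, map_sub, map_smul, map_pow, map_add, Polynomial.aeval_X, map_one, ← hB, hQ,
      pow_three' B, sq B]
  have hQQ : (Q * Q).trace = (c * (s * (t + 1) ^ 2)) ^ 2 := by
    rw [← hqQ, ← map_mul, trace_aeval_adjMatrix, hG, sum_map_gridExtensionSpectrum s t (by omega)]
    simp only [q, Polynomial.eval_mul, Polynomial.eval_sub, Polynomial.eval_pow,
      Polynomial.eval_add, Polynomial.eval_X, Polynomial.eval_one, Polynomial.eval_smul,
      smul_eq_mul, hc]
    ring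
  have hQJ : Q * J = (c * (s * (t + 1) ^ 2)) • J := by
    simp only [hQ, sub_mul, mul_assoc, smul_mul_assoc, hBJ, mul_smul_comm, hc]
    module
  have hJQ : J * Q = (c * (s * (t + 1) ^ 2)) • J := by
    simp only [hQ, mul_sub, ← mul_assoc, smul_mul_assoc, hJB, mul_smul_comm, hc]
    module
  have hQt : Q.transpose = Q := by
    simp only [hQ, Matrix.transpose_sub, Matrix.transpose_mul, Matrix.transpose_smul, hBt,
      mul_assoc]
  -- `q` at the valency is `c` times the order, so the trace of `(Q - c J)²` cancels.
  have hzero : Q - c • J = 0 := by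
    rw [← Matrix.trace_conjTranspose_mul_self_eq_zero_iff,
      Matrix.conjTranspose_eq_transpose_of_trivial, Matrix.transpose_sub, Matrix.transpose_smul,
      hQt, hJt]
    simp only [mul_sub, sub_mul, smul_mul_assoc, mul_smul_comm, hQJ, hJQ, hJJ, Matrix.trace_sub,
      Matrix.trace_smul, hQQ, hJtr, smul_eq_mul]
    ring
  rw [← sub_eq_zero.1 hzero, hQ]
  module

/-- A co-edge-regular graph with the spectrum of the clique extension of the grid is grid-like. -/
theorem isGridLike_of_adjSpectrum (hs : 2 ≤ s) (ht : 1 ≤ t) (hreg : G.IsCoEdgeRegular)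
    (hG : G.adjSpectrum = gridExtensionSpectrum s t) : G.IsGridLike s t := by
  obtain ⟨⟨k, hk⟩, μ, hμ⟩ := hreg
  have hμs := mu_of_adjSpectrum hs ht hG hk hμ
  subst hμs
  have hk' := degree_of_adjSpectrum hs hG hk
  have hn := card_of_adjSpectrum hs hG
  have hcub := cubic_of_adjSpectrum hs hG hk
  have hcard : ∀ x, #(G.closedNbhd x) = s * (2 * t + 1) := by
    intro x
    rw [closedNbhd, card_insert_of_notMem (by simp), card_neighborFinset_eq_degree, hk.degree_eq]
    have : (k : ℝ) + 1 = s * (2 * t + 1) := by rw [hk']; ring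
    exact_mod_cast this
  have hinter : ∀ x y, y ∉ G.closedNbhd x → #(G.closedNbhd x ∩ G.closedNbhd y) = 2 * s := by
    intro x y hxy
    have h1 : y ≠ x ∧ ¬ G.Adj x y := by simpa [mem_closedNbhd] using hxy
    rw [← hμ x y h1.1.symm h1.2, ← Set.toFinset_card]
    congr 1
    ext z
    simp only [mem_inter, mem_closedNbhd, Set.mem_toFinset, mem_commonNeighbors]
    constructor
    · rintro ⟨rfl | h2, rfl | h3⟩
      · exact absurd rfl h1.1
      · exact absurd h3.symm h1.2
      · exact absurd h2 h1.2
      · exact ⟨h2, h3⟩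
    · exact fun h => ⟨Or.inr h.1, Or.inr h.2⟩
  have hB : ∀ x y, (G.adjMatrix ℝ + 1) x y = if y ∈ G.closedNbhd x then 1 else 0 :=
    adjMatrix_add_one_apply
  have hBJ : (G.adjMatrix ℝ + 1) * allOnes V = (s * (2 * t + 1) : ℝ) • allOnes V := by
    rw [add_mul, adjMatrix_mul_allOnes hk, hk', one_mul]
    module
  have hJB : allOnes V * (G.adjMatrix ℝ + 1) = (s * (2 * t + 1) : ℝ) • allOnes V := by
    rw [mul_add, allOnes_mul_adjMatrix hk, hk', mul_one]
    module
  have hJJ : allOnes V * allOnes V = (s * (t + 1) ^ 2 : ℝ) • allOnes V := by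
    rw [allOnes_mul_allOnes, hn]
    push_cast
    rfl
  set B := G.adjMatrix ℝ + 1
  set J := allOnes V with hJ
  set D := B * B - (2 * s : ℝ) • J - (s * (t - 1) : ℝ) • B with hD
  have hBB : ∀ x y, (B * B) x y = #(G.closedNbhd x ∩ G.closedNbhd y) := by
    intro x y
    have : G.closedNbhd x ∩ G.closedNbhd y =
        ({w | y ∈ G.closedNbhd w ∧ w ∈ G.closedNbhd x} : Finset V) := by
      ext w
      rw [mem_inter, mem_filter_univ, mem_closedNbhd_comm (x := y), and_comm]
    simp only [Matrix.mul_apply, hB, ← ite_and, mul_ite, mul_one, mul_zero, sum_boole, this]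
  have hDd : ∀ x y, D x y = G.defect s t x y := by
    intro x y
    simp only [hD, Matrix.sub_apply, Matrix.smul_apply, hBB, hB, hJ, allOnes, Matrix.of_apply,
      smul_eq_mul]
    by_cases hxy : y ∈ G.closedNbhd x
    · rw [defect_of_mem hxy, if_pos hxy]
      ring
    · rw [defect_of_notMem hxy, if_neg hxy, hinter x y hxy]
      push_cast
      ring
  have hBD : B * D = (s ^ 2 * t : ℝ) • B := by
    simp only [hD, mul_sub, mul_smul_comm, hBJ, ← mul_assoc, hcub]
    module
  have hJD : J * D = (s ^ 2 * t : ℝ) • J := by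
    simp only [hD, mul_sub, mul_smul_comm, hJB, hJJ, ← mul_assoc, smul_mul_assoc]
    module
  have hDD : D * D = (s ^ 2 * t : ℝ) • D := by
    calc D * D = (B * B - (2 * s : ℝ) • J - (s * (t - 1) : ℝ) • B) * D := by rw [← hD]
      _ = _ := by
        simp only [sub_mul, mul_assoc B, smul_mul_assoc, hBD, hJD, mul_smul_comm]
        rw [hD]
        module
  refine ⟨hcard, hinter, fun z y => ?_, fun y => ?_, fun x y => ?_⟩
  · have := congrFun (congrFun hBD z) y
    rw [Matrix.mul_apply, Matrix.smul_apply, hB] at this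
    simpa only [hB, hDd, ite_mul, one_mul, zero_mul, smul_eq_mul, mul_ite, mul_one, mul_zero,
      sum_ite_mem, univ_inter] using this
  · have := congrFun (congrFun hJD y) y
    simpa [Matrix.mul_apply, hJ, allOnes, hDd] using this
  · have := congrFun (congrFun hDD x) y
    simpa only [Matrix.mul_apply, Matrix.smul_apply, hDd, smul_eq_mul] using this

/-! ### The spectrum of the clique extension of the grid -/

lemma roots_charpoly_allOnes {n : ℕ} (hn : 1 ≤ n) :
    (allOnes (Fin n)).charpoly.roots = (n : ℝ) ::ₘ Multiset.replicate (n - 1) 0 := by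
  have h1 : allOnes (Fin n) = Matrix.vecMulVec 1 1 := by
    ext i j
    simp [allOnes, Matrix.vecMulVec_apply]
  have h2 : (allOnes (Fin n)).charpoly =
      (Polynomial.X - Polynomial.C (n : ℝ)) * Polynomial.X ^ (n - 1) := by
    rw [h1, Matrix.charpoly_vecMulVec, sub_mul, mul_pow_sub_one (by omega), Fintype.card_fin,
      Polynomial.smul_eq_C_mul]
    simp
  rw [h2, Polynomial.roots_mul (mul_ne_zero (Polynomial.X_sub_C_ne_zero _)
    (pow_ne_zero _ Polynomial.X_ne_zero)), Polynomial.roots_X_sub_C, Polynomial.roots_pow,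
    Polynomial.roots_X, Multiset.nsmul_singleton, Multiset.singleton_add]

/-- A diagonalization of the all-ones matrix. -/
lemma exists_diagonalization_allOnes {n : ℕ} (hn : 1 ≤ n) :
    ∃ (U W : Matrix (Fin n) (Fin n) ℝ) (e : Fin n → ℝ), W * U = 1 ∧ U * W = 1 ∧
      allOnes (Fin n) = U * Matrix.diagonal e * W ∧
      univ.val.map e = (n : ℝ) ::ₘ Multiset.replicate (n - 1) 0 := by
  have hJ : (allOnes (Fin n)).IsHermitian := by
    ext i j
    simp [allOnes]
  refine ⟨hJ.eigenvectorUnitary, star hJ.eigenvectorUnitary, hJ.eigenvalues, ?_, ?_, ?_, ?_⟩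
  · simp
  · simp
  · exact hJ.spectral_theorem
  · rw [← roots_charpoly_allOnes hn, hJ.roots_charpoly_eq_eigenvalues]
    rfl

open scoped Kronecker in
/-- In terms of all-ones matrices `J`, the adjacency matrix of the clique extension is
`(J ⊗ 1 + 1 ⊗ J - 1) ⊗ J - 1`. -/
lemma adjMatrix_cliqueExtension_squareGrid (n s : ℕ) :
    ((squareGrid n).cliqueExtension s).adjMatrix ℝ =
      (allOnes (Fin n) ⊗ₖ 1 + 1 ⊗ₖ allOnes (Fin n) - 1) ⊗ₖ allOnes (Fin s) - 1 := by
  ext ⟨⟨i, j⟩, l⟩ ⟨⟨i', j'⟩, l'⟩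
  simp only [adjMatrix_apply, cliqueExtension, squareGrid, boxProd_adj, top_adj, Matrix.sub_apply,
    Matrix.kronecker_apply, Matrix.add_apply, allOnes, Matrix.of_apply, Matrix.one_apply,
    Prod.mk.injEq]
  by_cases hi : i = i' <;> by_cases hj : j = j' <;> by_cases hl : l = l' <;> simp [hi, hj, hl]

lemma roots_charpoly_of_diagonalization {m : Type*} [Fintype m] [DecidableEq m]
    (P Q : Matrix m m ℝ) (d : m → ℝ) (h : Q * P = 1) :
    (P * Matrix.diagonal d * Q).charpoly.roots = univ.val.map d := by
  rw [Matrix.charpoly_mul_comm, ← mul_assoc, h, one_mul, Matrix.charpoly_diagonal,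
    Polynomial.roots_prod _ _ (prod_ne_zero_iff.2 fun i _ => Polynomial.X_sub_C_ne_zero _)]
  simp

lemma _root_.Multiset.bind_sprod {α β γ : Type*} (S : Multiset α) (T : Multiset β)
    (d : α × β → Multiset γ) : (S ×ˢ T).bind d = S.bind fun a => T.bind fun b => d (a, b) := by
  change (Multiset.bind S fun a => T.map (Prod.mk a)).bind d = _
  simp only [Multiset.bind_assoc, Multiset.bind_map]

lemma _root_.Multiset.map_sprod {α β γ : Type*} (S : Multiset α) (T : Multiset β)
    (d : α × β → γ) : (S ×ˢ T).map d = S.bind fun a => T.map fun b => d (a, b) := by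
  change (Multiset.bind S fun a => T.map (Prod.mk a)).map d = _
  simp only [Multiset.map_bind, Multiset.map_map, Function.comp_def]

open scoped Kronecker in
lemma adjSpectrum_cliqueExtension_eq_bind {n s : ℕ} (hn : 1 ≤ n) (hs : 1 ≤ s) :
    ((squareGrid n).cliqueExtension s).adjSpectrum =
      ((n : ℝ) ::ₘ Multiset.replicate (n - 1) 0).bind fun a =>
      ((n : ℝ) ::ₘ Multiset.replicate (n - 1) 0).bind fun b =>
      ((s : ℝ) ::ₘ Multiset.replicate (s - 1) 0).map fun c => (a + b - 1) * c - 1 := by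
  obtain ⟨U, W, e, hWU, hUW, hJ, he⟩ := exists_diagonalization_allOnes hn
  obtain ⟨U', W', f, hWU', hUW', hJ', hf⟩ := exists_diagonalization_allOnes hs
  have h1 : ((squareGrid n).cliqueExtension s).adjMatrix ℝ =
      ((U ⊗ₖ U) ⊗ₖ U') * Matrix.diagonal (fun p : (Fin n × Fin n) × Fin s =>
        (e p.1.1 + e p.1.2 - 1) * f p.2 - 1) * ((W ⊗ₖ W) ⊗ₖ W') := by
    have h2 : Matrix.diagonal (fun p : (Fin n × Fin n) × Fin s =>
        (e p.1.1 + e p.1.2 - 1) * f p.2 - 1) =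
        (Matrix.diagonal e ⊗ₖ 1 + 1 ⊗ₖ Matrix.diagonal e - 1) ⊗ₖ Matrix.diagonal f - 1 := by
      rw [← Matrix.diagonal_one, ← Matrix.diagonal_one, ← Matrix.diagonal_one,
        Matrix.diagonal_kronecker_diagonal, Matrix.diagonal_kronecker_diagonal,
        Matrix.diagonal_add, Matrix.diagonal_sub, Matrix.diagonal_kronecker_diagonal,
        Matrix.diagonal_sub]
      simp
    have h3 : allOnes (Fin n) ⊗ₖ (1 : Matrix (Fin n) (Fin n) ℝ) + 1 ⊗ₖ allOnes (Fin n) - 1 =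
        (U ⊗ₖ U) * (Matrix.diagonal e ⊗ₖ 1 + 1 ⊗ₖ Matrix.diagonal e - 1) * (W ⊗ₖ W) := by
      rw [mul_sub, mul_add, sub_mul, add_mul, ← Matrix.mul_kronecker_mul,
        ← Matrix.mul_kronecker_mul, ← Matrix.mul_kronecker_mul, ← Matrix.mul_kronecker_mul, mul_one,
        mul_one, ← Matrix.mul_kronecker_mul, hUW, ← hJ, Matrix.one_kronecker_one]
    have h4 : ((U ⊗ₖ U) ⊗ₖ U') * ((W ⊗ₖ W) ⊗ₖ W') = 1 := by
      rw [← Matrix.mul_kronecker_mul, ← Matrix.mul_kronecker_mul, hUW, hUW',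
        Matrix.one_kronecker_one, Matrix.one_kronecker_one]
    rw [adjMatrix_cliqueExtension_squareGrid, h2, h3, hJ', mul_sub ((U ⊗ₖ U) ⊗ₖ U'),
      sub_mul _ _ ((W ⊗ₖ W) ⊗ₖ W'), mul_one ((U ⊗ₖ U) ⊗ₖ U'), h4,
      ← Matrix.mul_kronecker_mul, ← Matrix.mul_kronecker_mul]
  have h5 : ((W ⊗ₖ W) ⊗ₖ W') * ((U ⊗ₖ U) ⊗ₖ U') = 1 := by
    rw [← Matrix.mul_kronecker_mul, ← Matrix.mul_kronecker_mul, hWU, hWU',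
      Matrix.one_kronecker_one, Matrix.one_kronecker_one]
  rw [adjSpectrum, h1, roots_charpoly_of_diagonalization _ _ _ h5, ← he, ← hf]
  simp only [Multiset.bind_map, Multiset.map_map, ← univ_product_univ, product_val,
    Multiset.map_sprod, Multiset.bind_sprod, Function.comp_def]

lemma _root_.Multiset.replicate_bind {α β : Type*} (m : ℕ) (a : α) (f : α → Multiset β) :
    (Multiset.replicate m a).bind f = m • f a := by
  induction m with
  | zero => simp
  | succ m ih => rw [Multiset.replicate_succ, Multiset.cons_bind, ih, succ_nsmul']

theorem adjSpectrum_cliqueExtension_squareGrid {s : ℕ} (t : ℕ) (hs : 1 ≤ s) :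
    ((squareGrid (t + 1)).cliqueExtension s).adjSpectrum = gridExtensionSpectrum s t := by
  rw [adjSpectrum_cliqueExtension_eq_bind (by omega) hs]
  obtain ⟨r, rfl⟩ := Nat.exists_eq_add_of_le' hs
  simp only [Multiset.cons_bind, Multiset.replicate_bind, Nat.add_sub_cancel,
    gridExtensionSpectrum, ← Multiset.singleton_add, ← Multiset.replicate_one]
  simp only [Multiset.map_add, Multiset.map_replicate, nsmul_add, Multiset.nsmul_replicate]
  push_cast
  have e1 : ((t : ℝ) + 1 + (t + 1) - 1) * (r + 1) - 1 = (r + 1) * (2 * t + 1) - 1 := by ring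
  have e2 : ((t : ℝ) + 1 + 0 - 1) * (r + 1) - 1 = (r + 1) * t - 1 := by ring
  have e3 : (0 + ((t : ℝ) + 1) - 1) * (r + 1) - 1 = (r + 1) * t - 1 := by ring
  have e4 : ((0 : ℝ) + 0 - 1) * (r + 1) - 1 = -(r + 1) - 1 := by ring
  have e5 : ∀ a b : ℝ, (a + b - 1) * 0 - 1 = -1 := fun a b => by ring
  rw [e1, e2, e3, e4, e5, e5, e5, e5, show 2 * t = t * 1 + t * 1 by ring,
    show r * (t + 1) ^ 2 = r + t * r + t * r + t * (t * r) by ring,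
    show t ^ 2 = t * (t * 1) by ring]
  simp only [Multiset.replicate_add]
  abel

end SimpleGraph

end

theorem theorem1p1 (s t : ℕ) (hs : 2 ≤ s) (ht : 1 ≤ t) :
    ((squareGrid (t + 1)).cliqueExtension s).adjSpectrum = gridExtensionSpectrum s t ∧
    ∀ (V : Type*) [Fintype V] [DecidableEq V] (Γ : SimpleGraph V) [DecidableRel Γ.Adj],
      Γ.IsCoEdgeRegular →
      Γ.adjSpectrum = gridExtensionSpectrum s t →
      11 * (s + 1) ^ 3 * (s + 2) ≤ t →
      Nonempty (Γ ≃g (squareGrid (t + 1)).cliqueExtension s) := by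
  refine ⟨SimpleGraph.adjSpectrum_cliqueExtension_squareGrid t (by omega),
    fun V _ _ Γ _ hreg hΓ hbound => ?_⟩
  refine (SimpleGraph.isGridLike_of_adjSpectrum hs ht hreg hΓ).nonempty_iso hs ?_
    (SimpleGraph.card_of_adjSpectrum hs hΓ)
  calc 132 * (s + 1) ^ 2 = 11 * ((s + 1) ^ 2 * (3 * 4)) := by ring
    _ ≤ 11 * ((s + 1) ^ 2 * ((s + 1) * (s + 2))) := by gcongr <;> omega
    _ = 11 * (s + 1) ^ 3 * (s + 2) := by ring
    _ ≤ t := hbound
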